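/- **Setting.** Write $S^4=\mathbb R^4\cup\{\infty\}$. For $k\ge 0$ let $\mathcal B^s_k$ be the set of smooth $SU(2)$-connections $A$ with a frame $F$ of the fibre over $\infty$, on $SU(2)$-bundles $E\to S^4$ with $c_2(E)=\frac1{8\pi^2}\int \mathrm{tr}(F_A\wedge F_A)=k$, modulo isomorphism. Let $\bar{\mathcal B}^s_k=\bigsqcup_{i\le k}\mathcal B^s_{k-i}\times \mathrm{Sym}^i(\mathbb R^4)$, with elements $[A,F,\mathbf x]$, $\mathbf x=\{x_1,\dots,x_i\}$. With $|F_A|^2=-\sum_{a<b}\mathrm{tr}(F_{ab}^2)$, the centre of mass and the scale $\lambda\ge0$ of such an element are given by $$z=\frac1k\Big(\frac1{8\pi^2}\int_{\mathbb R^4}y|F_A|^2d^4y+\sum_j x_j\Big),\qquad \lambda^2=\frac1{8\pi^2}\int_{\mathbb R^4}|y-z|^2|F_A|^2d^4y+\sum_j|x_j-z|^2 ,$$ and $\bar{\mathcal B}^s_k(\varepsilon)=\{\lambda\le\varepsilon\}$. Let $\Theta$ be the trivial framed connection and $c_k$ the origin counted $k$ times. Fix a smooth $\chi:\mathbb R\to[0,2)$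 with $\chi(t)=0$ for $t\le\frac12$ and $\chi(t)=1$ for $t\ge1$. Balls $B(y,r)$ are open. **Splicing.** Let $I$ be a finite set with multiplicities $m_i\ge 1$, $k=\sum_i m_i$. Let $\Delta^\circ_I(\delta)$ be the set of families $(y_i)_{i\in I}$ of distinct points of $\mathbb R^4$ with $\sum_i m_iy_i=0$ and $(\sum_i m_i|y_i|^2)^{1/2}<\delta$. Consider data $(y_i,[A_i,F_i,\mathbf x_i])_{i\in I}$ with $y_i\in\mathbb R^4$ and $[A_i,F_i,\mathbf x_i]$ of total charge $m_i$ and scale $\lambda_i$, which are separated: $8\sqrt{\lambda_i}+8\sqrt{\lambda_j}<|y_i-y_j|$ for $i\ne j$. Parallel translation of $F_i$ along the rays from $\infty$ trivializes the bundle of $A_i$ over $\mathbb R^4\setminus\{0\}$; let $a_i$ be the connection form of $A_i$ in this trivialization. The splicing map is $\gamma'((y_i,[A_i,F_i,\mathbf x_i])_i)=[A',F',\mathbf x']$, where $A'$ is the trivial connection off $\bigcup_iB(y_i,4\sqrt{\lambda_i})$, is the translate of $A_i$ by $y_i$ on $B(y_i,2\sqrt{\lambda_i})$, and on the annulus between these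 balls has the connection form $x\mapsto(1-\chi(|x-y_i|/4\sqrt{\lambda_i}))\,a_i(x-y_i)$ in the trivialization just described, which is identified with the trivial one; $F'$ is the standard frame, and $\mathbf x'=\bigcup_i(y_i+\mathbf x_i)$. Given $\delta>0$ and constants $d_m>0$ let $\tilde{\mathcal O}_I(\delta,d)$ be the set of separated data with $(y_i)\in\Delta^\circ_I(\delta)$, $[A_i,F_i,\mathbf x_i]\in\bar{\mathcal B}^s_{m_i}(d_{m_i})$ and $\gamma'(\cdot)\in\bar{\mathcal B}^s_k(2\delta)$. Let $D_I(\delta,d)\subset\tilde{\mathcal O}_I(\delta,d)$ be the subset where, with $\lambda$ the scale of the image under $\gamma'$, one has for all $i$ $$\overline{B(y_i,4\lambda_i^{1/2})}\subset B(0,2\lambda^{1/2}),\qquad \overline{B(y_i,\tfrac14\lambda_i^{1/3})}\subset B(0,\tfrac18\lambda^{1/2}).$$ **Overlap data.** Let $\mathcal P,\mathcal P'$ be partitions of $N_\kappa=\{1,\dots,\kappa\}$ with $\mathcal P<\mathcal P'$, i.e. every block of $\mathcal P'$ lies in a block of $\mathcal P$ (equality is allowed). Let $\mathfrak S(\mathcal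 P)$ be the stabilizer of $\mathcal P$ in the symmetric group $\mathfrak S_\kappa$, and $[\mathcal P<\mathcal P']$ the set of partitions $\mathcal P''$ in the $\mathfrak S_\kappa$-orbit of $\mathcal P'$ with $\mathcal P<\mathcal P''$. For a partition $\mathcal Q$, use $I=\mathcal Q$ with multiplicities $m_Q=|Q|$ above. For $P\in\mathcal P$ let $\mathcal P''_P=\{Q\in\mathcal P'':Q\subseteq P\}$. Fix $\delta>0$ and positive constants $d_m$, $e_m$, $m\ge0$ (so that constants attached to a block depend on its size only). For $\mathcal P<\mathcal P''$ let $$\nu(\mathcal P,\mathcal P'')=\Delta^\circ_{\mathcal P}(\delta)\times\prod_{P\in\mathcal P}\Big(\Delta^\circ_{\mathcal P''_P}(d_{|P|})\times\prod_{Q\in\mathcal P''_P}\bar{\mathcal B}^s_{|Q|}(e_{|Q|})\Big),$$ with elements $\mathbf A=((y_P),(x_Q),[A_Q,F_Q,\mathbf x_Q])$. The up map is $\rho^u(\mathbf A)=(y_P+x_Q,[A_Q,F_Q,\mathbf x_Q])_{Q\in\mathcal P''}$, where $Q\subseteq P$. The down map is $\rho^d(\mathbf A)=(y_P,[A_P,F_P,\mathbf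 x_P])_{P\in\mathcal P}$, where $[A_P,F_P,\mathbf x_P]=\gamma'((x_Q,[A_Q,F_Q,\mathbf x_Q])_{Q\in\mathcal P''_P})$ if $P\notin\mathcal P''$ and is the given element if $P\in\mathcal P''$. The overlap data space $\tilde{\mathcal O}(\mathcal P,\mathcal P'')$ is the set of $\mathbf A\in\nu(\mathcal P,\mathcal P'')$ such that $(y_P+x_Q)_Q\in\Delta^\circ_{\mathcal P''}(\delta)$, $\rho^u(\mathbf A)\in\tilde{\mathcal O}_{\mathcal P''}(\delta,e)$, $(x_Q,[A_Q,F_Q,\mathbf x_Q])_{Q\in\mathcal P''_P}\in D_{\mathcal P''_P}(d_{|P|},e)$ for each $P\in\mathcal P\setminus\mathcal P''$, and $\rho^d(\mathbf A)\in\tilde{\mathcal O}_{\mathcal P}(\delta,d)$. Let $$\mathcal O_{\mathcal P}=\tilde{\mathcal O}_{\mathcal P}(\delta,d)/\mathfrak S(\mathcal P),\quad \mathcal O_{\mathcal P''}=\tilde{\mathcal O}_{\mathcal P''}(\delta,e)/\mathfrak S(\mathcal P''),\quad \mathcal O(\mathcal P,[\mathcal P'])=\Big(\bigsqcup_{\mathcal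 P''\in[\mathcal P<\mathcal P']}\tilde{\mathcal O}(\mathcal P,\mathcal P'')\Big)/\mathfrak S(\mathcal P),$$ where the symmetric groups act by permuting the blocks. **Theorem.** 1. For each $\mathcal P''\in[\mathcal P<\mathcal P']$ there is an open set $N$ of pairs $((y_P)_{P\in\mathcal P},(x_Q)_{Q\in\mathcal P''})$ containing $(y,0)$ for all $y\in\Delta^\circ_{\mathcal P}(\delta)$, such that every element of $\nu(\mathcal P,\mathcal P'')$ with $((y_P),(x_Q))\in N$ and $[A_Q,F_Q,\mathbf x_Q]=[\Theta,c_{|Q|}]$ for all $Q$ belongs to $\tilde{\mathcal O}(\mathcal P,\mathcal P'')$. 2. Splicing is associative: $\gamma'(\rho^u(\mathbf A))=\gamma'(\rho^d(\mathbf A))$ for all $\mathbf A\in\tilde{\mathcal O}(\mathcal P,\mathcal P')$. 3. The maps $\rho^u$, $\rho^d$ and $\gamma'$ pass to the quotients by the symmetric groups, and the following square of induced maps commutes: $$\begin{array}{ccc}\mathcal O(\mathcal P,[\mathcal P'])&\xrightarrow{\ \rho^u\ }&\Big(\bigsqcup_{\mathcal P''\in[\mathcal P<\mathcal P']}\mathcal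 O_{\mathcal P''}\Big)/\mathfrak S(\mathcal P)\\ {\scriptstyle\rho^d}\downarrow&&\downarrow{\scriptstyle\gamma'}\\ \mathcal O_{\mathcal P}&\xrightarrow{\ \gamma'\ }&\bar{\mathcal B}^s_\kappa(2\delta)\end{array}$$ -/

import Mathlib

open Matrix MeasureTheory Filter Topology
open scoped ContDiff Matrix.Norms.L2Operator

/-! ### Framed `SU(2)` connections on the four-sphere -/

/-- Euclidean four-space, with its Lebesgue measure.  The four-sphere is `R4 ∪ {∞}`;
the origin is the north pole and `∞` is the south pole. -/
abbrev R4 : Type := EuclideanSpace ℝ (Fin 4)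

abbrev M2 : Type := Matrix (Fin 2) (Fin 2) ℂ

/-- The group `SU(2)`. -/
abbrev SU2 : Submonoid M2 := Matrix.specialUnitaryGroup (Fin 2) ℂ

/-- The Lie algebra `su(2)`: skew-Hermitian trace-free matrices. -/
def su2 : Submodule ℝ M2 where
  carrier := {ξ | star ξ = -ξ ∧ ξ.trace = 0}
  add_mem' := by
    rintro a b ⟨ha, ha'⟩ ⟨hb, hb'⟩
    refine ⟨?_, ?_⟩
    · rw [star_add, ha, hb]; abel
    · rw [Matrix.trace_add, ha', hb', add_zero]
  zero_mem' := by simp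
  smul_mem' := by
    rintro c a ⟨ha, ha'⟩
    refine ⟨?_, ?_⟩
    · rw [star_smul, ha, star_trivial, smul_neg]
    · rw [Matrix.trace_smul, ha', smul_zero]

/-- A matrix-valued one-form on (a subset of) `R4`. -/
abbrev OneForm : Type := R4 → R4 →L[ℝ] M2

/-- The coordinate inversion `x ↦ x / |x|²`; its target is the coordinate chart of the
four-sphere centred at `∞`. -/
noncomputable def inv4 (x : R4) : R4 := (‖x‖ ^ 2)⁻¹ • x

/-- The gauge transform `h⁻¹ a h + h⁻¹ dh` at the point `x`, for `h` with values in `SU(2)`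
(so that `h⁻¹ = h^*`). -/
noncomputable def gaugeTransform (h : R4 → M2) (a : OneForm) (x v : R4) : M2 :=
  star (h x) * a x v * h x + star (h x) * fderiv ℝ h x v

/-- A connection on a principal `SU(2)`-bundle over the four-sphere together with a frame of the
fibre over `∞`, written in a smooth section of the bundle over the complement of a finite set
`sing ⊂ R4` (a neighbourhood of `∞` is in the domain of the section) whose value
at `∞` is the given frame.  The connection is then a smooth one-form `form` which
extends smoothly over `∞`, and around each point of `sing` there is another smooth section (given
by the gauge transformation `g` from the first one on the punctured ball) in which the connection
form extends smoothly over the point. Every framed connection on every `SU(2)`-bundle over the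
four-sphere is of this form, because the bundle is trivial over the complement of a point; the
values of `form` on `sing` have no meaning. -/
structure FramedConnection where
  sing : Set R4
  sing_finite : sing.Finite
  form : OneForm
  form_mem : ∀ x v, form x v ∈ su2
  form_smooth : ContDiffOn ℝ ∞ form singᶜ
  extends_sing : ∀ s ∈ sing, ∃ ε > 0, ∃ (g : R4 → M2) (b : OneForm),
    (∀ x, g x ∈ SU2) ∧ ContDiffOn ℝ ∞ g (Metric.ball s ε \ {s}) ∧
    ContDiffOn ℝ ∞ b (Metric.ball s ε) ∧
    ∀ x ∈ Metric.ball s ε \ {s}, ∀ v, b x v = gaugeTransform g form x v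
  extends_infty : ∃ ε > 0, ∃ b : OneForm, ContDiffOn ℝ ∞ b (Metric.ball 0 ε) ∧
    ∀ x, ε⁻¹ < ‖x‖ → form x = (b (inv4 x)).comp (fderiv ℝ inv4 x)

/-- Gauge equivalence, i.e. isomorphism of framed bundles with connection: a smooth gauge
transformation off a finite set, smooth near `∞` and equal to the identity at `∞`, which
carries one connection form to the other.  (At the points of the finite set it extends smoothly in
local smooth sections, since it intertwines connections which are smooth there.) -/
def GaugeEquivalent (A B : FramedConnection) : Prop :=
  ∃ (T : Set R4) (h : R4 → M2), T.Finite ∧ A.sing ⊆ T ∧ B.sing ⊆ T ∧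
    (∀ x, h x ∈ SU2) ∧ ContDiffOn ℝ ∞ h Tᶜ ∧
    (∀ x ∉ T, ∀ v, B.form x v = gaugeTransform h A.form x v) ∧
    ∃ ε > 0, ∃ k : R4 → M2, ContDiffOn ℝ ∞ k (Metric.ball 0 ε) ∧ k 0 = 1 ∧
      ∀ x, ε⁻¹ < ‖x‖ → h x = k (inv4 x)

theorem SU2_star_mul {g : M2} (hg : g ∈ SU2) : star g * g = 1 :=
  (Matrix.mem_unitaryGroup_iff').1 (Matrix.mem_specialUnitaryGroup_iff.1 hg).1

theorem SU2_mul_star {g : M2} (hg : g ∈ SU2) : g * star g = 1 :=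
  (Matrix.mem_unitaryGroup_iff).1 (Matrix.mem_specialUnitaryGroup_iff.1 hg).1

theorem SU2_star_mem {g : M2} (hg : g ∈ SU2) : star g ∈ SU2 := by
  rw [Matrix.mem_specialUnitaryGroup_iff] at hg ⊢
  refine ⟨Unitary.star_mem hg.1, ?_⟩
  rw [Matrix.star_eq_conjTranspose, Matrix.det_conjTranspose, hg.2, star_one]

/-- Hermitian conjugation as a real-linear continuous map. -/
noncomputable def starM2 : M2 →L[ℝ] M2 :=
  LinearMap.toContinuousLinearMap
    { toFun := fun m => star m
      map_add' := fun a b => star_add a b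
      map_smul' := fun c a => by rw [star_smul, star_trivial, RingHom.id_apply] }

theorem starM2_apply (m : M2) : starM2 m = star m := rfl

theorem hasFDerivAt_star {h : R4 → M2} {x : R4} (hh : DifferentiableAt ℝ h x) :
    HasFDerivAt (fun y => star (h y)) (starM2.comp (fderiv ℝ h x)) x :=
  starM2.hasFDerivAt.comp x hh.hasFDerivAt

theorem fderiv_star_comp {h : R4 → M2} {x : R4} (hh : DifferentiableAt ℝ h x) (v : R4) :
    fderiv ℝ (fun y => star (h y)) x v = star (fderiv ℝ h x v) := by
  rw [(hasFDerivAt_star hh).fderiv]; rfl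

theorem fderiv_mul_apply {f g : R4 → M2} {x : R4} (hf : DifferentiableAt ℝ f x)
    (hg : DifferentiableAt ℝ g x) (v : R4) :
    fderiv ℝ (fun y => f y * g y) x v = f x * fderiv ℝ g x v + fderiv ℝ f x v * g x := by
  have h1 : HasFDerivAt (fun y => f y * g y) _ x := hf.hasFDerivAt.mul' hg.hasFDerivAt
  rw [h1.fderiv]; simp

theorem star_fderiv_mul {h : R4 → M2} {x : R4} (hm : ∀ y, h y ∈ SU2)
    (hh : DifferentiableAt ℝ h x) (v : R4) :
    star (fderiv ℝ h x v) * h x = -(star (h x) * fderiv ℝ h x v) := by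
  have h1 := fderiv_mul_apply (hasFDerivAt_star hh).differentiableAt hh v
  have h2 : (fun y => star (h y) * h y) = fun _ => (1 : M2) := by
    funext y; exact SU2_star_mul (hm y)
  rw [h2, fderiv_star_comp hh, fderiv_const_apply] at h1
  have h3 : 0 = star (h x) * fderiv ℝ h x v + star (fderiv ℝ h x v) * h x := h1
  exact eq_neg_of_add_eq_zero_right h3.symm

theorem mul_star_fderiv {h : R4 → M2} {x : R4} (hm : ∀ y, h y ∈ SU2)
    (hh : DifferentiableAt ℝ h x) (v : R4) :
    h x * star (fderiv ℝ h x v) = -(fderiv ℝ h x v * star (h x)) := by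
  have h1 := fderiv_mul_apply hh (hasFDerivAt_star hh).differentiableAt v
  have h2 : (fun y => h y * star (h y)) = fun _ => (1 : M2) := by
    funext y; exact SU2_mul_star (hm y)
  rw [h2, fderiv_star_comp hh, fderiv_const_apply] at h1
  have h3 : 0 = h x * star (fderiv ℝ h x v) + fderiv ℝ h x v * star (h x) := h1
  exact eq_neg_of_add_eq_zero_left h3.symm

theorem differentiableAt_of_compl {E : Type*} [NormedAddCommGroup E] [NormedSpace ℝ E]
    {h : R4 → E} {T : Set R4} (hT : T.Finite) (hh : ContDiffOn ℝ ∞ h Tᶜ) {x : R4} (hx : x ∉ T) :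
    DifferentiableAt ℝ h x :=
  (hh.contDiffAt (hT.isClosed.isOpen_compl.mem_nhds hx)).differentiableAt (by simp)

theorem contDiffOn_star {h : R4 → M2} {T : Set R4} (hh : ContDiffOn ℝ ∞ h T) :
    ContDiffOn ℝ ∞ (fun y => star (h y)) T :=
  starM2.contDiff.comp_contDiffOn hh

theorem contDiffOn_mul {f g : R4 → M2} {T : Set R4} (hf : ContDiffOn ℝ ∞ f T)
    (hg : ContDiffOn ℝ ∞ g T) : ContDiffOn ℝ ∞ (fun y => f y * g y) T :=
  hf.mul hg

theorem GaugeEquivalent.refl (A : FramedConnection) : GaugeEquivalent A A := by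
  refine ⟨A.sing, fun _ => 1, A.sing_finite, subset_rfl, subset_rfl, fun _ => one_mem _,
    contDiffOn_const, ?_, 1, one_pos, fun _ => 1, contDiffOn_const, rfl, fun _ _ => rfl⟩
  intro x _ v
  simp [gaugeTransform]

theorem GaugeEquivalent.symm {A B : FramedConnection} (hAB : GaugeEquivalent A B) :
    GaugeEquivalent B A := by
  obtain ⟨T, h, hT, hA, hB, hm, hs, hg, ε, hε, k, hk, hk0, hk1⟩ := hAB
  refine ⟨T, fun x => star (h x), hT, hB, hA, fun x => SU2_star_mem (hm x), contDiffOn_star hs,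
    ?_, ε, hε, fun x => star (k x), contDiffOn_star hk, by simp [hk0], fun x hx =>
      congrArg star (hk1 x hx)⟩
  intro x hx v
  have hd := differentiableAt_of_compl hT hs hx
  rw [gaugeTransform, hg x hx v, gaugeTransform, fderiv_star_comp hd, star_star,
    mul_star_fderiv hm hd]
  have e := SU2_mul_star (hm x)
  calc A.form x v = (h x * star (h x)) * A.form x v * (h x * star (h x)) := by rw [e]; simp
    _ = _ := by
      have e3 : h x * (star (h x) * fderiv ℝ h x v) = fderiv ℝ h x v := by
        rw [← mul_assoc, e, one_mul]
      rw [mul_add, add_mul, e3]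
      simp only [mul_assoc]; abel

theorem GaugeEquivalent.trans {A B C : FramedConnection} (hAB : GaugeEquivalent A B)
    (hBC : GaugeEquivalent B C) : GaugeEquivalent A C := by
  obtain ⟨T, h, hT, hA, hB, hm, hs, hg, ε, hε, k, hk, hk0, hk1⟩ := hAB
  obtain ⟨T', h', hT', hB', hC', hm', hs', hg', ε', hε', k', hk', hk0', hk1'⟩ := hBC
  refine ⟨T ∪ T', fun x => h x * h' x, hT.union hT', hA.trans Set.subset_union_left,
    hC'.trans Set.subset_union_right, fun x => mul_mem (hm x) (hm' x),
    contDiffOn_mul (hs.mono (Set.compl_subset_compl.2 Set.subset_union_left))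
      (hs'.mono (Set.compl_subset_compl.2 Set.subset_union_right)), ?_,
    min ε ε', lt_min hε hε', fun x => k x * k' x,
    contDiffOn_mul (hk.mono (Metric.ball_subset_ball (min_le_left _ _)))
      (hk'.mono (Metric.ball_subset_ball (min_le_right _ _))), by simp [hk0, hk0'], ?_⟩
  · intro x hx v
    rw [Set.mem_union, not_or] at hx
    have hd := differentiableAt_of_compl hT hs hx.1
    have hd' := differentiableAt_of_compl hT' hs' hx.2
    rw [hg' x hx.2 v, gaugeTransform, hg x hx.1 v, gaugeTransform, gaugeTransform,
      fderiv_mul_apply hd hd', star_mul]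
    have e := SU2_star_mul (hm x)
    have e2 : star (h' x) * star (h x) * (h x * fderiv ℝ h' x v)
        = star (h' x) * fderiv ℝ h' x v := by
      rw [mul_assoc, ← mul_assoc (star (h x)), e, one_mul]
    rw [mul_add (star (h' x) * star (h x)), e2]
    simp only [mul_add, add_mul, mul_assoc]; abel
  · intro x hx
    exact congrArg₂ (· * ·) (hk1 x ((inv_anti₀ (lt_min hε hε') (min_le_left _ _)).trans_lt hx))
      (hk1' x ((inv_anti₀ (lt_min hε hε') (min_le_right _ _)).trans_lt hx))

instance FramedConnection.setoid : Setoid FramedConnection where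
  r := GaugeEquivalent
  iseqv := ⟨GaugeEquivalent.refl, GaugeEquivalent.symm, GaugeEquivalent.trans⟩

/-- The disjoint union over all charges of the framed quotient spaces. -/
abbrev FramedClass : Type := Quotient FramedConnection.setoid

/-! ### Curvature, charge and energy -/

/-- The curvature `F = da + a ∧ a`. -/
noncomputable def curvature (a : OneForm) (x v w : R4) : M2 :=
  fderiv ℝ a x v w - fderiv ℝ a x w v + (a x v * a x w - a x w * a x v)

/-- The components of the curvature in the standard coordinates. -/
noncomputable def curvatureComp (a : OneForm) (x : R4) (i j : Fin 4) : M2 :=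
  curvature a x (EuclideanSpace.single i 1) (EuclideanSpace.single j 1)

/-- The function `|F|²` for the norm `|ξ|² = -tr (ξ ξ)` on `su(2)`. -/
noncomputable def energyDensity (a : OneForm) (x : R4) : ℝ :=
  ∑ i : Fin 4, ∑ j : Fin 4,
    if i < j then -(curvatureComp a x i j * curvatureComp a x i j).trace.re else 0

/-- The coefficient of the four-form `tr (F ∧ F)`. -/
noncomputable def chernDensity (a : OneForm) (x : R4) : ℝ :=
  2 * (curvatureComp a x 0 1 * curvatureComp a x 2 3
    - curvatureComp a x 0 2 * curvatureComp a x 1 3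
    + curvatureComp a x 0 3 * curvatureComp a x 1 2).trace.re

theorem curvature_gaugeTransform {h : R4 → M2} {a b : OneForm} {x : R4}
    (hm : ∀ y, h y ∈ SU2) (hh : ContDiffAt ℝ ∞ h x) (ha : DifferentiableAt ℝ a x)
    (hb : DifferentiableAt ℝ b x)
    (hab : ∀ᶠ y in 𝓝 x, ∀ v, b y v = gaugeTransform h a y v) (v w : R4) :
    curvature b x v w = star (h x) * curvature a x v w * h x := by
  have hd : DifferentiableAt ℝ h x := hh.differentiableAt (by simp)
  have hdd : DifferentiableAt ℝ (fderiv ℝ h) x :=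
    (hh.fderiv_right (m := ∞) (by simp)).differentiableAt (by simp)
  have hds := (hasFDerivAt_star hd).differentiableAt
  have key : ∀ v w : R4, fderiv ℝ b x v w =
      star (fderiv ℝ h x v) * a x w * h x + star (h x) * fderiv ℝ a x v w * h x
        + star (h x) * a x w * fderiv ℝ h x v + star (fderiv ℝ h x v) * fderiv ℝ h x w
        + star (h x) * fderiv ℝ (fderiv ℝ h) x v w := by
    intro v w
    have e1 : fderiv ℝ b x v w = fderiv ℝ (fun y => b y w) x v := by
      have := (hb.hasFDerivAt.clm_apply (hasFDerivAt_const w x)).fderiv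
      rw [this]; simp
    have ea : HasFDerivAt (fun y => a y w) ((fderiv ℝ a x).flip w) x := by
      have := ha.hasFDerivAt.clm_apply (hasFDerivAt_const w x)
      simpa using this
    have eh : HasFDerivAt (fun y => fderiv ℝ h y w) ((fderiv ℝ (fderiv ℝ h) x).flip w) x := by
      have := hdd.hasFDerivAt.clm_apply (hasFDerivAt_const w x)
      simpa using this
    have e2 : (fun y => b y w) =ᶠ[𝓝 x]
        fun y => star (h y) * a y w * h y + star (h y) * fderiv ℝ h y w :=
      hab.mono fun y hy => hy w
    have e3 : HasFDerivAt (fun y => star (h y) * a y w * h y + star (h y) * fderiv ℝ h y w) _ x := ((((hasFDerivAt_star hd).mul' ea).mul' hd.hasFDerivAt).add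
      ((hasFDerivAt_star hd).mul' eh))
    rw [e1, e2.fderiv_eq, HasFDerivAt.fderiv e3]
    simp [starM2_apply, mul_assoc]
    abel
  have hsymm : fderiv ℝ (fderiv ℝ h) x v w = fderiv ℝ (fderiv ℝ h) x w v :=
    (hh.isSymmSndFDerivAt (by
      simp only [minSmoothness_of_isRCLikeNormedField]
      exact WithTop.coe_le_coe.2 (le_top : (2 : ℕ∞) ≤ ⊤))) v w
  have hx := hab.self_of_nhds
  have s1 := star_fderiv_mul hm hd
  have e := SU2_mul_star (hm x)
  have s2 : ∀ v, star (fderiv ℝ h x v) = -(star (h x) * fderiv ℝ h x v * star (h x)) := by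
    intro v
    calc star (fderiv ℝ h x v) = star (fderiv ℝ h x v) * h x * star (h x) := by
          rw [mul_assoc, e, mul_one]
      _ = _ := by rw [s1, neg_mul]
  have e' : ∀ m : M2, h x * (star (h x) * m) = m := fun m => by rw [← mul_assoc, e, one_mul]
  unfold curvature
  rw [key, key, hx v, hx w, gaugeTransform, gaugeTransform, hsymm, s2 v, s2 w]
  simp only [mul_add, add_mul, mul_sub, sub_mul, neg_mul, mul_assoc, e']
  abel

theorem trace_conj_mul {g F G : M2} (hg : g ∈ SU2) :
    ((star g * F * g) * (star g * G * g)).trace = (F * G).trace := by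
  have e := SU2_mul_star hg
  have e1 : (star g * F * g) * (star g * G * g) = star g * (F * G * g) := by
    calc _ = star g * F * (g * star g) * G * g := by simp only [mul_assoc]
      _ = _ := by rw [e]; simp only [mul_assoc, mul_one]
  rw [e1, Matrix.trace_mul_comm, mul_assoc, e, mul_one]

theorem GaugeEquivalent.exists_curvature {A B : FramedConnection} (hAB : GaugeEquivalent A B) :
    ∃ (T : Set R4) (h : R4 → M2), T.Finite ∧ (∀ x, h x ∈ SU2) ∧ ∀ x ∉ T, ∀ i j,
      curvatureComp B.form x i j = star (h x) * curvatureComp A.form x i j * h x := by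
  obtain ⟨T, h, hT, hA, hB, hm, hs, hg, -⟩ := hAB
  refine ⟨T, h, hT, hm, fun x hx i j => ?_⟩
  have hx' : Tᶜ ∈ 𝓝 x := hT.isClosed.isOpen_compl.mem_nhds hx
  exact curvature_gaugeTransform hm (hs.contDiffAt hx')
    (differentiableAt_of_compl A.sing_finite A.form_smooth fun h' => hx (hA h'))
    (differentiableAt_of_compl B.sing_finite B.form_smooth fun h' => hx (hB h'))
    (Filter.mem_of_superset hx' fun y hy v => hg y hy v) _ _

theorem GaugeEquivalent.energyDensity_ae {A B : FramedConnection} (hAB : GaugeEquivalent A B) :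
    energyDensity A.form =ᵐ[volume] energyDensity B.form := by
  obtain ⟨T, h, hT, hm, hF⟩ := hAB.exists_curvature
  refine Filter.mem_of_superset (compl_mem_ae_iff.2 (hT.measure_zero volume)) fun x hx => ?_
  simp only [Set.mem_ofPred_eq, energyDensity, hF x hx, trace_conj_mul (hm x)]

theorem GaugeEquivalent.chernDensity_ae {A B : FramedConnection} (hAB : GaugeEquivalent A B) :
    chernDensity A.form =ᵐ[volume] chernDensity B.form := by
  obtain ⟨T, h, hT, hm, hF⟩ := hAB.exists_curvature
  refine Filter.mem_of_superset (compl_mem_ae_iff.2 (hT.measure_zero volume)) fun x hx => ?_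
  simp only [Set.mem_ofPred_eq, chernDensity, hF x hx, Matrix.trace_add, Matrix.trace_sub,
    trace_conj_mul (hm x)]

/-- The second Chern number `(1 / 8π²) ∫ tr (F ∧ F)` of the underlying bundle. -/
noncomputable def FramedClass.charge : FramedClass → ℝ :=
  Quotient.lift (fun A => (8 * Real.pi ^ 2)⁻¹ * ∫ x, chernDensity A.form x) fun _ _ hAB => by
    simp only [integral_congr_ae (GaugeEquivalent.chernDensity_ae hAB)]

/-- `∫ y |F|² d⁴y`. -/
noncomputable def FramedClass.firstMoment : FramedClass → R4 :=
  Quotient.lift (fun A => ∫ x, energyDensity A.form x • x) fun _ _ hAB =>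
    integral_congr_ae ((GaugeEquivalent.energyDensity_ae hAB).mono fun x hx => by
      simp only [hx])

/-- `∫ |y - z|² |F|² d⁴y`. -/
noncomputable def FramedClass.secondMoment (z : R4) : FramedClass → ℝ :=
  Quotient.lift (fun A => ∫ x, ‖x - z‖ ^ 2 * energyDensity A.form x) fun _ _ hAB =>
    integral_congr_ae ((GaugeEquivalent.energyDensity_ae hAB).mono fun x hx => by
      simp only [hx])

/-! ### Ideal connections -/

/-- A framed ideal connection `[A, F, x]`: a framed connection modulo gauge together with a point
`x` of a symmetric product of `R4`, of any charge. -/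
structure IdealConnection where
  conn : FramedClass
  pts : Multiset R4

/-- The centre of mass of an ideal connection of total charge `k`. -/
noncomputable def IdealConnection.center (k : ℕ) (c : IdealConnection) : R4 :=
  (k : ℝ)⁻¹ • ((8 * Real.pi ^ 2)⁻¹ • c.conn.firstMoment + c.pts.sum)

/-- The scale of an ideal connection of total charge `k`. -/
noncomputable def IdealConnection.scale (k : ℕ) (c : IdealConnection) : ℝ :=
  Real.sqrt ((8 * Real.pi ^ 2)⁻¹ * c.conn.secondMoment (c.center k)
    + (c.pts.map fun x => ‖x - c.center k‖ ^ 2).sum)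

/-- The space of framed ideal connections of total charge `k` and scale at most `ε`: the union over
`i ≤ k` of framed connections of charge `k - i` together with points of the `i`-th symmetric
product. -/
def idealSpace (k : ℕ) (ε : ℝ) : Set IdealConnection :=
  {c | c.pts.card ≤ k ∧ c.conn.charge = (k : ℝ) - c.pts.card ∧ c.scale k ≤ ε}

/-- The trivial framed connection. -/
noncomputable def trivialConnection : FramedConnection where
  sing := ∅
  sing_finite := Set.finite_empty
  form := fun _ => 0
  form_mem := fun _ _ => su2.zero_mem
  form_smooth := contDiffOn_const
  extends_sing := fun _ hs => hs.elim
  extends_infty := ⟨1, one_pos, fun _ => 0, contDiffOn_const, fun _ _ => by simp⟩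

/-- The ideal connection `[Θ, c_k]`: the trivial connection with the origin counted `k` times. -/
noncomputable def coneIdeal (k : ℕ) : IdealConnection := ⟨⟦trivialConnection⟧, Multiset.replicate k 0⟩

/-! ### The splicing map -/

/-- A cut-off function. -/
structure CutOff where
  toFun : ℝ → ℝ
  smooth : ContDiff ℝ ∞ toFun
  mem_Ico : ∀ t, toFun t ∈ Set.Ico (0 : ℝ) 2
  eq_zero : ∀ t, t ≤ 1 / 2 → toFun t = 0
  eq_one : ∀ t, 1 ≤ t → toFun t = 1

/-- The function `1 - χ(|x - y| / r)` on the open ball `B(y, r)`, extended by zero. -/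
noncomputable def CutOff.weight (χ : CutOff) (y : R4) (r : ℝ) (x : R4) : ℝ :=
  if ‖x - y‖ < r then 1 - χ.toFun (‖x - y‖ / r) else 0

theorem CutOff.weight_eq_one (χ : CutOff) {y : R4} {r : ℝ} {x : R4} (h : ‖x - y‖ < r / 2) :
    χ.weight y r x = 1 := by
  have hr : 0 < r := by linarith [norm_nonneg (x - y)]
  rw [CutOff.weight, if_pos (by linarith), χ.eq_zero, sub_zero]
  rw [div_le_iff₀ hr]; linarith

theorem CutOff.weight_eq_zero (χ : CutOff) {y : R4} {r : ℝ} {x : R4} (h : r ≤ ‖x - y‖) :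
    χ.weight y r x = 0 := by
  rw [CutOff.weight, if_neg (not_lt.2 h)]

theorem CutOff.contDiff_weight (χ : CutOff) (y : R4) (r : ℝ) : ContDiff ℝ ∞ (χ.weight y r) := by
  rcases le_or_gt r 0 with hr | hr
  · have : χ.weight y r = fun _ => 0 := by
      funext x; exact χ.weight_eq_zero (hr.trans (norm_nonneg _))
    rw [this]; exact contDiff_const
  rw [contDiff_iff_contDiffAt]
  intro x
  rcases eq_or_ne x y with rfl | hxy
  · have : χ.weight x r =ᶠ[𝓝 x] fun _ => 1 := by
      filter_upwards [Metric.ball_mem_nhds x (half_pos hr)] with z hz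
      exact χ.weight_eq_one (by rwa [mem_ball_iff_norm] at hz)
    exact contDiffAt_const.congr_of_eventuallyEq this
  · have : χ.weight y r = fun x => 1 - χ.toFun (‖x - y‖ / r) := by
      funext z
      by_cases hz : ‖z - y‖ < r
      · rw [CutOff.weight, if_pos hz]
      · rw [CutOff.weight, if_neg hz, χ.eq_one _ ((one_le_div hr).2 (not_lt.1 hz)), sub_self]
    rw [this]
    have h1 : ContDiffAt ℝ ∞ (fun x : R4 => ‖x - y‖) x :=
      (contDiffAt_id.sub contDiffAt_const).norm ℝ (sub_ne_zero.2 hxy)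
    exact contDiffAt_const.sub (χ.smooth.contDiffAt.comp x (h1.div_const r))

/-- The section in which `A` is written is, on the exterior of `B(0, r)`, the section obtained
from the frame at `∞` by parallel translation along the great circles through `∞` and the
origin, that is, along rays: there it is smooth, and the connection form has no radial component. -/
def FramedConnection.IsParallelOutside (A : FramedConnection) (r : ℝ) : Prop :=
  A.sing ⊆ Metric.ball 0 r ∧ ∀ x, r ≤ ‖x‖ → A.form x x = 0

theorem trivialConnection_isParallelOutside (r : ℝ) : trivialConnection.IsParallelOutside r :=
  ⟨fun _ h => h.elim, fun _ _ => rfl⟩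

theorem form_comp_sub_smooth (A : FramedConnection) (y : R4) :
    ContDiffOn ℝ ∞ (fun x => A.form (x - y)) ((fun z => y + z) '' A.sing)ᶜ := by
  refine A.form_smooth.comp (contDiff_id.sub contDiff_const).contDiffOn ?_
  intro x hx hx'
  exact hx ⟨x - y, hx', by simp⟩

/-- Splicing framed connections `A i` to the trivial connection at the points `y i`.  The section
in which each `A i` is written must be the parallel one on the exterior of `B(0, 2 √(lam i))`.
In the trivial section of the complement of the balls and the translated sections of the `A i`,
which coincide on the overlaps, the spliced connection form is zero off the balls
`B(y i, 4 √(lam i))`, the product of `1 - χ` with the translate of the form of `A i` on the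
annuli, and the translate of the form of `A i` on the balls `B(y i, 2 √(lam i))`. -/
noncomputable def spliceConnections (χ : CutOff) {ι : Type} [Fintype ι] (y : ι → R4)
    (lam : ι → ℝ) (A : ι → FramedConnection)
    (hA : ∀ i, (A i).IsParallelOutside (2 * Real.sqrt (lam i)))
    (hsep : ∀ i j, i ≠ j → 8 * Real.sqrt (lam i) + 8 * Real.sqrt (lam j) < dist (y i) (y j)) :
    FramedConnection where
  sing := ⋃ i, (fun z => y i + z) '' (A i).sing
  sing_finite := Set.finite_iUnion fun i => (A i).sing_finite.image _
  form := fun x => ∑ i, χ.weight (y i) (4 * Real.sqrt (lam i)) x • (A i).form (x - y i)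
  form_mem := fun x v => by
    rw [_root_.sum_apply]
    exact su2.sum_mem fun i _ => su2.smul_mem _ ((A i).form_mem _ _)
  form_smooth := by
    refine ContDiffOn.sum fun i _ => ?_
    refine (χ.contDiff_weight _ _).contDiffOn.smul ((form_comp_sub_smooth (A i) (y i)).mono ?_)
    exact Set.compl_subset_compl.2 (Set.subset_iUnion (fun i => (fun z => y i + z) '' (A i).sing) i)
  extends_sing := by
    intro s hs
    obtain ⟨i, s0, hs0, rfl⟩ := Set.mem_iUnion.1 hs
    obtain ⟨ε, hε, g, b, hg, hgs, hbs, hgb⟩ := (A i).extends_sing s0 hs0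
    have hr : ‖s0‖ < 2 * Real.sqrt (lam i) := by simpa using (hA i).1 hs0
    have hform : ∀ x, ‖x - y i‖ < 2 * Real.sqrt (lam i) →
        (∑ j, χ.weight (y j) (4 * Real.sqrt (lam j)) x • (A j).form (x - y j))
          = (A i).form (x - y i) := by
      intro x hx
      rw [Finset.sum_eq_single i]
      · rw [χ.weight_eq_one (by linarith), one_smul]
      · intro j _ hj
        rw [χ.weight_eq_zero]
        · exact zero_smul ℝ ((A j).form (x - y j))
        have h1 := hsep i j (Ne.symm hj)
        have h2 : dist (y i) (y j) ≤ ‖x - y i‖ + ‖x - y j‖ := by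
          rw [dist_eq_norm, ← norm_neg (x - y i)]
          calc ‖y i - y j‖ = ‖-(x - y i) + (x - y j)‖ := by congr 1; abel
            _ ≤ _ := norm_add_le _ _
        linarith [Real.sqrt_nonneg (lam i), Real.sqrt_nonneg (lam j)]
      · intro h; exact absurd (Finset.mem_univ i) h
    have htrans : ∀ {ρ : ℝ} {x : R4}, ρ ≤ ε → x ∈ Metric.ball (y i + s0) ρ →
        x - y i ∈ Metric.ball s0 ε := by
      intro ρ x hρ hx
      rw [mem_ball_iff_norm] at hx ⊢
      rw [sub_sub]; exact hx.trans_le hρ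
    have hne : ∀ {x : R4}, x ≠ y i + s0 → x - y i ≠ s0 := by
      intro x hx h; exact hx (by rw [← h]; abel)
    refine ⟨min ε (2 * Real.sqrt (lam i) - ‖s0‖), lt_min hε (by linarith),
      fun x => g (x - y i), fun x => b (x - y i), fun x => hg _, ?_, ?_, ?_⟩
    · refine hgs.comp (contDiff_id.sub contDiff_const).contDiffOn ?_
      rintro x ⟨hx, hx'⟩
      exact ⟨htrans (min_le_left _ _) hx, hne hx'⟩
    · refine hbs.comp (contDiff_id.sub contDiff_const).contDiffOn ?_
      intro x hx
      exact htrans (min_le_left _ _) hx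
    · rintro x ⟨hx, hx'⟩ v
      have hx1 : ‖x - y i‖ < 2 * Real.sqrt (lam i) := by
        rw [mem_ball_iff_norm] at hx
        have h3 := hx.trans_le (min_le_right _ _)
        have h4 : ‖x - y i‖ ≤ ‖x - (y i + s0)‖ + ‖s0‖ := by
          calc ‖x - y i‖ = ‖(x - (y i + s0)) + s0‖ := by congr 1; abel
            _ ≤ _ := norm_add_le _ _
        linarith
      rw [hgb _ ⟨htrans (min_le_left _ _) hx, hne hx'⟩ v, gaugeTransform, gaugeTransform,
        hform x hx1, fderiv_comp_sub]
  extends_infty := by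
    set R : ℝ := ∑ i, (‖y i‖ + 4 * Real.sqrt (lam i)) with hR
    have hnn : ∀ i, 0 ≤ ‖y i‖ + 4 * Real.sqrt (lam i) := fun i => by positivity
    have hR0 : 0 ≤ R := Finset.sum_nonneg fun i _ => hnn i
    refine ⟨(R + 1)⁻¹, by positivity, fun _ => 0, contDiffOn_const, ?_⟩
    intro x hx
    rw [inv_inv] at hx
    rw [ContinuousLinearMap.zero_comp]
    refine Finset.sum_eq_zero fun i _ => ?_
    rw [χ.weight_eq_zero]
    · exact zero_smul ℝ ((A i).form (x - y i))
    have h1 : ‖y i‖ + 4 * Real.sqrt (lam i) ≤ R :=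
      Finset.single_le_sum (f := fun i => ‖y i‖ + 4 * Real.sqrt (lam i)) (fun i _ => hnn i)
        (Finset.mem_univ i)
    linarith [norm_sub_norm_le x (y i)]

open Classical in
/-- A representative of the class `c` written in a section which is parallel along rays on the
exterior of `B(0, r)`.  For `0 < r` there always is one, by parallel translation from `∞`; the
other branch only makes the function total. -/
noncomputable def parallelRep (c : FramedClass) (r : ℝ) : FramedConnection :=
  if h : ∃ A : FramedConnection, (⟦A⟧ : FramedClass) = c ∧ A.IsParallelOutside r then h.choose
  else trivialConnection

theorem parallelRep_isParallelOutside (c : FramedClass) (r : ℝ) :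
    (parallelRep c r).IsParallelOutside r := by
  unfold parallelRep
  split_ifs with h
  · exact h.choose_spec.2
  · exact trivialConnection_isParallelOutside r

/-- Splicing data for clusters indexed by `ι`: the splicing points `y i` and the framed ideal
connections `[A i, F i, x i]`. -/
structure SplicingDatum (ι : Type) where
  pt : ι → R4
  ideal : ι → IdealConnection

/-- The scale of the `i`-th ideal connection, of total charge `m i`. -/
noncomputable def SplicingDatum.scale {ι : Type} (m : ι → ℕ) (D : SplicingDatum ι) (i : ι) : ℝ :=
  (D.ideal i).scale (m i)

/-- The condition `8 √λ_i + 8 √λ_j < dist (y_i, y_j)` for distinct `i` and `j`. -/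
def SplicingDatum.Separated {ι : Type} (m : ι → ℕ) (D : SplicingDatum ι) : Prop :=
  ∀ i j, i ≠ j →
    8 * Real.sqrt (D.scale m i) + 8 * Real.sqrt (D.scale m j) < dist (D.pt i) (D.pt j)

open Classical in
/-- The splicing map to the trivial connection on `R4`.  It is used only on separated data. The
connections are spliced and their singular points are translated. -/
noncomputable def splicingMap (χ : CutOff) {ι : Type} [Fintype ι] (m : ι → ℕ)
    (D : SplicingDatum ι) : IdealConnection where
  conn :=
    if h : D.Separated m then
      ⟦spliceConnections χ D.pt (D.scale m)
        (fun i => parallelRep (D.ideal i).conn (2 * Real.sqrt (D.scale m i)))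
        (fun _ => parallelRep_isParallelOutside _ _) h⟧
    else ⟦trivialConnection⟧
  pts := ∑ i, (D.ideal i).pts.map fun x => D.pt i + x

/-- The open diagonal of mass-centred configurations of scale less than `δ`, for clusters of
multiplicities `m i`.  A vector in which the entries of each block of a partition coincide, and
different blocks have different entries, is recorded by the entry `y i` of each block. -/
def openDiagonal {ι : Type} [Fintype ι] (m : ι → ℕ) (δ : ℝ) : Set (ι → R4) :=
  {y | Function.Injective y ∧ ∑ i, m i • y i = 0 ∧ Real.sqrt (∑ i, m i * ‖y i‖ ^ 2) < δ}

/-- The domain of the splicing map for clusters of multiplicities `m i` and total charge `k`: the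
points are in the open diagonal, the `i`-th ideal connection has total charge `m i` and scale at
most `d (m i)`, the datum is separated, and its image under the splicing map is in the space of
framed ideal connections of total charge `k` and scale at most `2 δ`. -/
def splicingDomain (χ : CutOff) {ι : Type} [Fintype ι] (m : ι → ℕ) (k : ℕ) (δ : ℝ) (d : ℕ → ℝ) :
    Set (SplicingDatum ι) :=
  {D | D.pt ∈ openDiagonal m δ ∧ (∀ i, D.ideal i ∈ idealSpace (m i) (d (m i))) ∧ D.Separated m ∧
    splicingMap χ m D ∈ idealSpace k (2 * δ)}

/-- The data in the splicing domain for which, with `λ` the scale of the spliced ideal connection,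
the closures of `B(y_i, 4 λ_i^(1/2))` and of `B(y_i, (1/4) λ_i^(1/3))` are contained in
`B(0, 2 λ^(1/2))` and in `B(0, (1/8) λ^(1/2))` respectively. -/
def concentratedDomain (χ : CutOff) {ι : Type} [Fintype ι] (m : ι → ℕ) (k : ℕ) (δ : ℝ)
    (d : ℕ → ℝ) : Set (SplicingDatum ι) :=
  {D | D ∈ splicingDomain χ m k δ d ∧ ∀ i,
    closure (Metric.ball (D.pt i) (4 * Real.sqrt (D.scale m i))) ⊆
      Metric.ball 0 (2 * Real.sqrt ((splicingMap χ m D).scale k)) ∧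
    closure (Metric.ball (D.pt i) (1 / 4 * D.scale m i ^ (1 / 3 : ℝ))) ⊆
      Metric.ball 0 (1 / 8 * Real.sqrt ((splicingMap χ m D).scale k))}

/-! ### Partitions and overlap data

`Q ≤ P` in `Finpartition` means that `Q` is a refinement of `P`. -/

abbrev SetPartition (κ : ℕ) : Type := Finpartition (Finset.univ : Finset (Fin κ))

/-- The multiplicities of the blocks of a partition. -/
def blockCard {κ : ℕ} (P : SetPartition κ) (B : P.parts) : ℕ := B.1.card

/-- The partition of the set `B` by the blocks of `Q` contained in it. -/
abbrev BlocksIn {κ : ℕ} (Q : SetPartition κ) (B : Finset (Fin κ)) : Type :=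
  {C : Finset (Fin κ) // C ∈ Q.parts ∧ C ⊆ B}

/-- The multiplicities of the blocks of `Q` contained in `B`. -/
def blockInCard {κ : ℕ} (Q : SetPartition κ) (B : Finset (Fin κ)) (C : BlocksIn Q B) : ℕ :=
  C.1.card

/-- The permutation `σ` takes the partition `P` to `Q`. -/
def Carries {κ : ℕ} (σ : Equiv.Perm (Fin κ)) (P Q : SetPartition κ) : Prop :=
  Q.parts = P.parts.image fun B => B.map σ.toEmbedding

/-- The set of refinements of `P` which are conjugate to `P'` under the symmetric group. -/
def conjugateRefinements {κ : ℕ} (P P' : SetPartition κ) : Set (SetPartition κ) :=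
  {Q | (∃ σ, Carries σ P' Q) ∧ Q ≤ P}

/-- Points `(y, x, [A, F, x])` of the product of configurations indexed by the blocks of `P`, by
those of `Q`, and ideal connections indexed by the blocks of `Q`. -/
structure OverlapDatum {κ : ℕ} (P Q : SetPartition κ) where
  base : P.parts → R4
  off : Q.parts → R4
  ideal : Q.parts → IdealConnection

/-- The projection of overlap data to the factor of the block `B` of `P`. -/
def OverlapDatum.fibre {κ : ℕ} {P Q : SetPartition κ} (a : OverlapDatum P Q) (B : P.parts) :
    SplicingDatum (BlocksIn Q B.1) where
  pt C := a.off ⟨C.1, C.2.1⟩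
  ideal C := a.ideal ⟨C.1, C.2.1⟩

/-- The block of `P` which contains a given block of its refinement `Q`. -/
noncomputable def parentBlock {κ : ℕ} {P Q : SetPartition κ} (h : Q ≤ P) (C : Q.parts) : P.parts :=
  ⟨(h C.2).choose, (h C.2).choose_spec.1⟩

/-- The upwards overlap map: the points `y_B + x_C` for `C ⊆ B`, and the given ideal
connections. -/
noncomputable def overlapUp {κ : ℕ} {P Q : SetPartition κ} (h : Q ≤ P) (a : OverlapDatum P Q) :
    SplicingDatum Q.parts where
  pt C := a.base (parentBlock h C) + a.off C
  ideal := a.ideal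

open Classical in
/-- The downwards overlap map: the points `y_B`, and the ideal connections obtained by splicing in
each block `B` of `P`.  If `B` is a block of `Q` as well, the ideal connection is left alone. -/
noncomputable def overlapDown (χ : CutOff) {κ : ℕ} {P Q : SetPartition κ} (a : OverlapDatum P Q) :
    SplicingDatum P.parts where
  pt := a.base
  ideal B := if hB : B.1 ∈ Q.parts then a.ideal ⟨B.1, hB⟩
    else splicingMap χ (blockInCard Q B.1) (a.fibre B)

/-- The overlap data space: the product of the open diagonal of `P`, the open diagonals of the
partitions which `Q` induces on the blocks of `P`, and the spaces of ideal connections for the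
blocks of `Q`. -/
def overlapSpace {κ : ℕ} (P Q : SetPartition κ) (δ : ℝ) (d e : ℕ → ℝ) : Set (OverlapDatum P Q) :=
  {a | a.base ∈ openDiagonal (blockCard P) δ ∧
    (∀ B : P.parts, (a.fibre B).pt ∈ openDiagonal (blockInCard Q B.1) (d B.1.card)) ∧
    ∀ C : Q.parts, a.ideal C ∈ idealSpace C.1.card (e C.1.card)}

/-- The set of overlap data on which the overlap maps and their compositions with the splicing maps
are defined and which splice to concentrated connections in each block of `P` that is not a block
of `Q`. -/
def overlapDomain (χ : CutOff) {κ : ℕ} {P Q : SetPartition κ} (h : Q ≤ P) (δ : ℝ)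
    (d e : ℕ → ℝ) : Set (OverlapDatum P Q) :=
  {a | a ∈ overlapSpace P Q δ d e ∧
    (overlapUp h a).pt ∈ openDiagonal (blockCard Q) δ ∧
    overlapUp h a ∈ splicingDomain χ (blockCard Q) κ δ e ∧
    (∀ B : P.parts, B.1 ∉ Q.parts →
      a.fibre B ∈ concentratedDomain χ (blockInCard Q B.1) B.1.card (d B.1.card) e) ∧
    overlapDown χ a ∈ splicingDomain χ (blockCard P) κ δ d}

/-! ### Symmetric group quotients -/

/-- The permutation `σ` takes the splicing datum `D` for `P` to the splicing datum `E` for `Q`. -/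
def SplicingDatum.Moves {κ : ℕ} {P Q : SetPartition κ} (σ : Equiv.Perm (Fin κ))
    (D : SplicingDatum P.parts) (E : SplicingDatum Q.parts) : Prop :=
  Carries σ P Q ∧ ∀ (B : P.parts) (C : Q.parts), C.1 = B.1.map σ.toEmbedding →
    E.pt C = D.pt B ∧ E.ideal C = D.ideal B

/-- The permutation `σ` in the stabilizer of `P` takes the overlap datum `a` for the refinement `Q`
of `P` to the overlap datum `b` for the refinement `R`. -/
def OverlapDatum.Moves {κ : ℕ} {P Q R : SetPartition κ} (σ : Equiv.Perm (Fin κ))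
    (a : OverlapDatum P Q) (b : OverlapDatum P R) : Prop :=
  Carries σ P P ∧ Carries σ Q R ∧
    (∀ B C : P.parts, C.1 = B.1.map σ.toEmbedding → b.base C = a.base B) ∧
    ∀ (B : Q.parts) (C : R.parts), C.1 = B.1.map σ.toEmbedding →
      b.off C = a.off B ∧ b.ideal C = a.ideal B

/-- The domain of the splicing map for the partition `P`, divided by the stabilizer of `P`. -/
def SplicingQuotient (χ : CutOff) {κ : ℕ} (P : SetPartition κ) (δ : ℝ) (d : ℕ → ℝ) : Type :=
  Quot fun D E : splicingDomain χ (blockCard P) κ δ d =>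
    ∃ σ : Equiv.Perm (Fin κ), SplicingDatum.Moves σ D.1 E.1

/-- The disjoint union over the refinements `Q` of `P` conjugate to `P'` of the quotients
`SplicingQuotient` for `Q`, divided by the stabilizer of `P`. -/
def UpperQuotient (χ : CutOff) {κ : ℕ} (P P' : SetPartition κ) (δ : ℝ) (e : ℕ → ℝ) : Type :=
  Quot fun u v : (Q : conjugateRefinements P P') × SplicingQuotient χ Q.1 δ e =>
    ∃ σ : Equiv.Perm (Fin κ), Carries σ P P ∧
      ∃ (D : splicingDomain χ (blockCard u.1.1) κ δ e)
        (E : splicingDomain χ (blockCard v.1.1) κ δ e),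
        u.2 = Quot.mk _ D ∧ v.2 = Quot.mk _ E ∧ SplicingDatum.Moves σ D.1 E.1

/-- The disjoint union over the refinements `Q` of `P` conjugate to `P'` of the overlap domains,
divided by the stabilizer of `P`. -/
def OverlapQuotient (χ : CutOff) {κ : ℕ} (P P' : SetPartition κ) (δ : ℝ) (d e : ℕ → ℝ) : Type :=
  Quot fun u v : (Q : conjugateRefinements P P') × overlapDomain χ Q.2.2 δ d e =>
    ∃ σ : Equiv.Perm (Fin κ), OverlapDatum.Moves σ u.2.1 v.2.1

/-- The class of a splicing datum in `SplicingQuotient`. -/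
def SplicingQuotient.mk {χ : CutOff} {κ : ℕ} {P : SetPartition κ} {δ : ℝ} {d : ℕ → ℝ}
    (D : splicingDomain χ (blockCard P) κ δ d) : SplicingQuotient χ P δ d :=
  Quot.mk _ D

/-- The class in `UpperQuotient` of a splicing datum for a conjugate refinement `Q`. -/
def UpperQuotient.mk {χ : CutOff} {κ : ℕ} {P P' : SetPartition κ} {δ : ℝ} {e : ℕ → ℝ}
    (Q : conjugateRefinements P P') (D : splicingDomain χ (blockCard Q.1) κ δ e) :
    UpperQuotient χ P P' δ e :=
  Quot.mk _ ⟨Q, SplicingQuotient.mk D⟩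

/-- The class in `OverlapQuotient` of an overlap datum for a conjugate refinement `Q`. -/
def OverlapQuotient.mk {χ : CutOff} {κ : ℕ} {P P' : SetPartition κ} {δ : ℝ} {d e : ℕ → ℝ}
    (Q : conjugateRefinements P P') (a : overlapDomain χ Q.2.2 δ d e) :
    OverlapQuotient χ P P' δ d e :=
  Quot.mk _ ⟨Q, a⟩

/-! ### Rigidity of parallel sections -/

/-! The heart of the matter is associativity. Let `B` be a block of `P` that is not a block of the
refinement `Q`, and let `A` be the connection spliced from the clusters inside `B`, of scale `λ`.
Splicing `A` again could differ from splicing all clusters at once in two ways: the form is cut off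
between the radii `2√λ` and `4√λ`, and `A` is first replaced by a chosen representative of its class
that is parallel along rays outside `B(0, 2√λ)`. Neither matters.

The concentration condition puts every inner ball of radius `4√λ_C` inside `B(0, 2√λ)`, so `A`
vanishes outside that ball and nothing is left to cut off. The gauge transformation from `A` to the
chosen representative is constant along rays there, because neither form has a radial component, and
it is the identity at infinity. Hence it is the identity outside the ball
(`gauge_eq_one_of_radial`), and the representative vanishes there as well. Gauge transformations may
be singular at finitely many points; generic rays miss these, and continuity gives the rest. This
settles one block (`exists_gauge_block`). Separation keeps the translated balls of different blocks
disjoint, so the block transformations patch to a global one (`GaugeEquivalent.glue`), and the two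
spliced connections have the same class (`splicingMap_overlapUp`). The clusters themselves need no
analysis, since both sides use the same representatives of them. For the singular points,
associativity is composition of translations.

For trivial data all cluster scales are zero, and splicing returns the points themselves on the
trivial connection, with scale `√(∑ m_i |y_i|²)`. Once the product conditions hold, finitely many
open conditions on `(y, x)`, all true at `x = 0`, are enough for membership in the overlap domain;
the scale bound on the downward image follows from associativity.

The chosen representative depends only on the class and the radius, so splicing is insensitive to
relabelling of the blocks (`splicingMap_comp_equiv`). The maps therefore descend, and the square of
quotients can be checked on representatives. -/

theorem norm_inv4 (x : R4) : ‖inv4 x‖ = ‖x‖⁻¹ := by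
  rcases eq_or_ne x 0 with rfl | hx
  · simp [inv4]
  have : ‖x‖ ≠ 0 := norm_ne_zero_iff.2 hx
  rw [inv4, norm_smul, norm_inv, norm_pow, norm_norm]
  field_simp

theorem tendsto_inv4_smul {x : R4} (hx : x ≠ 0) :
    Tendsto (fun t : ℝ => inv4 (t • x)) atTop (𝓝 0) := by
  rw [tendsto_zero_iff_norm_tendsto_zero]
  simp only [norm_inv4, norm_smul]
  refine tendsto_inv_atTop_zero.comp ?_
  exact tendsto_norm_atTop_atTop.atTop_mul_const (norm_pos_iff.2 hx)

/-- Almost every ray avoids a finite set; the endpoints outside a closed ball of such rays are dense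
in the complement of the open ball. -/
theorem mem_closure_rays_avoiding {T : Set R4} (hT : T.Finite) {r : ℝ} {x : R4} (hx : r ≤ ‖x‖) :
    x ∈ closure {z : R4 | r < ‖z‖ ∧ z ≠ 0 ∧ ∀ t : ℝ, 1 ≤ t → t • z ∉ T} := by
  -- A ray meeting `s ∈ T` lies in the span of `s`, a proper subspace of a four-dimensional space
  -- and hence null. The complement of finitely many null sets is dense.
  have hdense : Dense {z : R4 | z ≠ 0 ∧ ∀ s ∈ T, z ∉ Submodule.span ℝ {s}} := by
    refine Measure.dense_of_ae (μ := volume) ?_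
    refine (Measure.ae_ne volume 0).and ((ae_ball_iff hT.countable).2 fun s _ => ?_)
    refine measure_eq_zero_iff_ae_notMem.1 (Measure.addHaar_submodule volume _ fun h => ?_)
    have h1 := finrank_span_le_card (R := ℝ) ({s} : Set R4)
    rw [h, finrank_top, finrank_euclideanSpace_fin] at h1
    simp at h1
  have hopen : IsOpen {z : R4 | r < ‖z‖} := isOpen_lt continuous_const continuous_norm
  -- In a nontrivial normed space the interior of a closed ball is the open ball for every radius,
  -- `0` included, so the case `‖x‖ = r` is covered.
  have hcl : x ∈ closure {z : R4 | r < ‖z‖} := by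
    have h1 : {z : R4 | r < ‖z‖} = (Metric.closedBall 0 r)ᶜ := by ext; simp
    rw [h1, closure_compl, interior_closedBall']
    simpa using hx
  refine closure_mono ?_ (closure_minimal (hdense.open_subset_closure_inter hopen)
    isClosed_closure hcl)
  rintro z ⟨hz, hz0, hzT⟩
  refine ⟨hz, hz0, fun t ht htT => hzT _ htT ?_⟩
  have : z = t⁻¹ • (t • z) := by rw [smul_smul, inv_mul_cancel₀ (by linarith), one_smul]
  exact Submodule.mem_span_singleton.2 ⟨t⁻¹, this.symm⟩

/-- A gauge transformation which is covariantly constant along the rays outside a ball where the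
connection is trivial, and the identity at infinity, is the identity outside the ball. -/
theorem gauge_eq_one_of_radial {A B : FramedConnection} {T : Set R4} {h k : R4 → M2} {r ε : ℝ}
    (hT : T.Finite) (hm : ∀ x, h x ∈ SU2) (hs : ContDiffOn ℝ ∞ h Tᶜ)
    (hg : ∀ x ∉ T, ∀ v, B.form x v = gaugeTransform h A.form x v) (hε : 0 < ε)
    (hk : ContDiffOn ℝ ∞ k (Metric.ball 0 ε)) (hk0 : k 0 = 1)
    (hk1 : ∀ x, ε⁻¹ < ‖x‖ → h x = k (inv4 x)) (hA : ∀ x, r ≤ ‖x‖ → A.form x = 0)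
    (hB : ∀ x, r ≤ ‖x‖ → B.form x x = 0) {x : R4} (hxT : x ∉ T) (hx : r ≤ ‖x‖) : h x = 1 := by
  have hray : ∀ z ∈ {z : R4 | r < ‖z‖ ∧ z ≠ 0 ∧ ∀ t : ℝ, 1 ≤ t → t • z ∉ T}, h z ∈ ({1} : Set M2) := by
    rintro z ⟨hz, hz0, hzT⟩
    have hpos : 0 < ‖z‖ := norm_pos_iff.2 hz0
    -- With `A` zero and `B` without radial component, the gauge law in the radial direction reads
    -- `0 = h⁻¹ dh`.
    have hrad : ∀ y, y ∉ T → r ≤ ‖y‖ → fderiv ℝ h y y = 0 := by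
      intro y hy hry
      have h1 := hg y hy y
      rw [hB y hry, gaugeTransform, hA y hry] at h1
      simp only [_root_.zero_apply, mul_zero, zero_mul, zero_add] at h1
      have h2 : h y * (star (h y) * fderiv ℝ h y y) = 0 := by rw [← h1, mul_zero]
      rwa [← mul_assoc, SU2_mul_star (hm y), one_mul] at h2
    have hder : ∀ t : ℝ, 1 ≤ t → HasDerivAt (fun t : ℝ => h (t • z)) 0 t := by
      intro t ht
      have ht0 : (0 : ℝ) < t := by linarith
      have hnorm : r ≤ ‖t • z‖ := by
        rw [norm_smul, Real.norm_of_nonneg ht0.le]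
        nlinarith
      have h1 := hrad _ (hzT t ht) hnorm
      rw [map_smul, smul_eq_zero] at h1
      have h2 := ((differentiableAt_of_compl hT hs (hzT t ht)).hasFDerivAt).comp_hasDerivAt t
        ((hasDerivAt_id t).smul_const z)
      have h3 : fderiv ℝ h (t • z) ((1 : ℝ) • z) = 0 := by
        rw [one_smul, h1.resolve_left ht0.ne']
      rw [← h3]; exact h2
    have hconst : ∀ t : ℝ, 1 ≤ t → h (t • z) = h z := by
      intro t ht
      have := constant_of_has_deriv_right_zero (f := fun t : ℝ => h (t • z)) (a := 1) (b := t)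
        (fun u hu => (hder u hu.1).continuousAt.continuousWithinAt)
        (fun u hu => (hder u hu.1).hasDerivWithinAt) t ⟨ht, le_rfl⟩
      simpa using this
    -- The constant value of `h` on the ray is its limit at infinity, which is `k 0 = 1` because
    -- `inv4` carries the end of the ray to the origin.
    have hkc : ContinuousAt k 0 :=
      (hk.contDiffAt (Metric.ball_mem_nhds 0 hε)).continuousAt
    have h1 : Tendsto (fun t : ℝ => k (inv4 (t • z))) atTop (𝓝 1) := by
      rw [← hk0]; exact hkc.tendsto.comp (tendsto_inv4_smul hz0)
    have h2 : (fun t : ℝ => k (inv4 (t • z))) =ᶠ[atTop] fun _ => h z := by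
      filter_upwards [eventually_ge_atTop 1, eventually_gt_atTop (ε⁻¹ / ‖z‖)] with t ht ht'
      rw [← hk1, hconst t ht]
      rwa [norm_smul, Real.norm_of_nonneg (by linarith), ← div_lt_iff₀ hpos]
    exact tendsto_nhds_unique (tendsto_const_nhds.congr' h2.symm) h1
  -- Points on rays that meet `T`, and points on the sphere of radius `r`, are limits of the good
  -- ones.
  have hcont : ContinuousAt h x := (differentiableAt_of_compl hT hs hxT).continuousAt
  have := hcont.continuousWithinAt.mem_closure (mem_closure_rays_avoiding hT hx) hray
  simpa using this

/-- The form of a connection which is parallel outside a ball vanishes there, if a gauge equivalent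
connection form does. -/
theorem GaugeEquivalent.exists_gauge_eq_one {A B : FramedConnection} {r : ℝ}
    (hAB : GaugeEquivalent A B) (hA : ∀ x, r ≤ ‖x‖ → A.form x = 0)
    (hB : B.IsParallelOutside r) :
    (∀ x, r ≤ ‖x‖ → B.form x = 0) ∧
    ∃ (T : Set R4) (h : R4 → M2), T.Finite ∧ A.sing ⊆ T ∧ B.sing ⊆ T ∧ (∀ x, h x ∈ SU2) ∧
      ContDiffOn ℝ ∞ h Tᶜ ∧ (∀ x ∉ T, ∀ v, B.form x v = gaugeTransform h A.form x v) ∧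
      ∀ x, r ≤ ‖x‖ → h x = 1 := by
  classical
  obtain ⟨T, h, hT, hAT, hBT, hm, hs, hg, ε, hε, k, hk, hk0, hk1⟩ := hAB
  have hone : ∀ x ∉ T, r ≤ ‖x‖ → h x = 1 := fun x hxT hx =>
    gauge_eq_one_of_radial hT hm hs hg hε hk hk0 hk1 hA hB.2 hxT hx
  -- The values of `h` on `T` are arbitrary. Resetting `h` to `1` outside the ball changes it only
  -- on `T`, so smoothness and the gauge law off `T` survive.
  have heq : ∀ x ∉ T, (if r ≤ ‖x‖ then 1 else h x) = h x := fun x hx => by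
    split_ifs with hr
    · exact (hone x hx hr).symm
    · rfl
  refine ⟨fun x hx => ?_, T, fun x => if r ≤ ‖x‖ then 1 else h x, hT, hAT, hBT, fun x => ?_,
    hs.congr heq, fun x hx v => ?_, fun x hx => if_pos hx⟩
  rotate_left
  · dsimp only
    split_ifs
    exacts [one_mem _, hm x]
  · have he : (fun x => if r ≤ ‖x‖ then 1 else h x) =ᶠ[𝓝 x] h :=
      Filter.mem_of_superset (hT.isClosed.isOpen_compl.mem_nhds hx) heq
    rw [hg x hx, gaugeTransform, gaugeTransform, he.fderiv_eq, he.eq_of_nhds]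
  have hx' : x ∉ B.sing := fun h' => by
    have := hB.1 h'
    rw [mem_ball_zero_iff] at this
    linarith
  have hcont : ContinuousAt B.form x :=
    (differentiableAt_of_compl B.sing_finite B.form_smooth hx').continuousAt
  -- Off `T` and strictly outside the ball, `h` is locally `1`, so the form of `B` equals that of
  -- `A`, which is zero. Since `B.sing` lies inside the ball, continuity extends this to every `x`
  -- with `r ≤ ‖x‖`.
  have := hcont.continuousWithinAt.mem_closure (t := {0}) (mem_closure_rays_avoiding hT hx) ?_
  · simpa using this
  rintro z ⟨hz, -, hzT⟩
  have hzT' : z ∉ T := by simpa using hzT 1 le_rfl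
  have hone' : h =ᶠ[𝓝 z] fun _ => 1 := by
    filter_upwards [hT.isClosed.isOpen_compl.mem_nhds hzT',
      (isOpen_lt continuous_const continuous_norm).mem_nhds hz] with w hw hw'
    exact hone w hw (le_of_lt hw')
  ext1 v
  rw [hg z hzT' v, gaugeTransform, hone'.fderiv_eq, hA z hz.le]
  simp

/-! ### Gluing gauge transformations -/

theorem fderiv_comp_sub_const (h : R4 → M2) (y x : R4) :
    fderiv ℝ (fun z => h (z - y)) x = fderiv ℝ h (x - y) :=
  fderiv_comp_sub y

/-- Gauge transformations between connection forms supported in disjoint balls, equal to the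
identity outside of the balls, are glued to one gauge transformation. -/
theorem GaugeEquivalent.glue {ι : Type} [Fintype ι] {C D : FramedConnection} (y : ι → R4)
    (R : ι → ℝ) (F G : ι → OneForm) (T : ι → Set R4) (h : ι → R4 → M2)
    (hsep : ∀ i j, i ≠ j → R i + R j < dist (y i) (y j))
    (hF : ∀ i x, R i ≤ ‖x‖ → F i x = 0) (hG : ∀ i x, R i ≤ ‖x‖ → G i x = 0)
    (hT : ∀ i, (T i).Finite) (hm : ∀ i x, h i x ∈ SU2) (hs : ∀ i, ContDiffOn ℝ ∞ (h i) (T i)ᶜ)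
    (hg : ∀ i, ∀ x ∉ T i, ∀ v, G i x v = gaugeTransform (h i) (F i) x v)
    (hone : ∀ i, ∀ x, R i ≤ ‖x‖ → h i x = 1)
    (hC : ∀ x, C.form x = ∑ i, F i (x - y i)) (hD : ∀ x, D.form x = ∑ i, G i (x - y i))
    (hCT : C.sing ⊆ ⋃ i, (fun z => y i + z) '' T i)
    (hDT : D.sing ⊆ ⋃ i, (fun z => y i + z) '' T i) : GaugeEquivalent C D := by
  have hsum : ∀ (H : ι → R4 → M2) (i : ι) (x : R4), (∀ j, j ≠ i → H j x = 0) →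
      ∑ j, H j x = H i x := fun H i x hH =>
    Finset.sum_eq_single i (fun j _ hj => hH j hj) fun hi => absurd (Finset.mem_univ i) hi
  have hfar : ∀ i j x, j ≠ i → ‖x - y i‖ ≤ R i → R j < ‖x - y j‖ := by
    intro i j x hij hx
    have h1 := hsep i j hij.symm
    have h2 : dist (y i) (y j) ≤ ‖x - y i‖ + ‖x - y j‖ := by
      rw [← dist_eq_norm, ← dist_eq_norm, dist_comm x]; exact dist_triangle _ _ _
    linarith
  have hnhds : ∀ j x, R j < ‖x - y j‖ → ∀ᶠ z in 𝓝 x, R j < ‖z - y j‖ := fun j x hx =>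
    (isOpen_lt continuous_const ((continuous_id.sub continuous_const).norm)).mem_nhds hx
  -- The balls are disjoint, so at most one summand differs from zero at any point, and `H` is there
  -- the corresponding `h i`.
  set H : R4 → M2 := fun x => 1 + ∑ i, (h i (x - y i) - 1) with hH
  have hH1 : ∀ x, (∀ i, R i ≤ ‖x - y i‖) → H x = 1 := by
    intro x hx
    simp only [hH]
    rw [Finset.sum_eq_zero fun i _ => by rw [hone i _ (hx i), sub_self], add_zero]
  have hHi : ∀ i x, (∀ j, j ≠ i → R j < ‖x - y j‖) → H x = h i (x - y i) := by
    intro i x hx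
    simp only [hH]
    rw [hsum (fun i x => h i (x - y i) - 1) i x fun j hj => by
      simp only [hone j _ (hx j hj).le, sub_self]]
    abel
  -- Both alternatives are open conditions, by strictness of the separation. Thus `H` agrees near
  -- each point with `1` or with a single translated `h i`, and its derivative can be read off.
  have hcases : ∀ x, (∀ i, R i < ‖x - y i‖) ∨ ∃ i, ∀ j, j ≠ i → R j < ‖x - y j‖ := by
    intro x
    by_cases hx : ∀ i, R i < ‖x - y i‖
    · exact Or.inl hx
    · push Not at hx
      obtain ⟨i, hi⟩ := hx
      exact Or.inr ⟨i, fun j hj => hfar i j x hj hi⟩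
  refine ⟨⋃ i, (fun z => y i + z) '' T i, H, Set.finite_iUnion fun i => (hT i).image _, hCT, hDT,
    ?_, ?_, ?_, ?_⟩
  · intro x
    rcases hcases x with hx | ⟨i, hi⟩
    · rw [hH1 x fun i => (hx i).le]; exact one_mem _
    · rw [hHi i x hi]; exact hm _ _
  · refine contDiffOn_const.add (ContDiffOn.sum fun i _ => ContDiffOn.sub ?_ contDiffOn_const)
    refine (hs i).comp (contDiff_id.sub contDiff_const).contDiffOn ?_
    intro x hx hx'
    exact hx (Set.mem_iUnion.2 ⟨i, x - y i, hx', by simp⟩)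
  · intro x hx v
    rw [gaugeTransform, hC x, hD x]
    rcases hcases x with hx' | ⟨i, hi⟩
    · have he : H =ᶠ[𝓝 x] fun _ => 1 :=
        (eventually_all.2 fun i => hnhds i x (hx' i)).mono fun z hz => hH1 z fun i => (hz i).le
      rw [he.fderiv_eq, Finset.sum_eq_zero fun i _ => hF i _ (hx' i).le,
        Finset.sum_eq_zero fun i _ => hG i _ (hx' i).le]
      simp
    · have he : H =ᶠ[𝓝 x] fun z => h i (z - y i) := by
        have : ∀ᶠ z in 𝓝 x, ∀ j, j ≠ i → R j < ‖z - y j‖ := by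
          refine eventually_all.2 fun j => ?_
          by_cases hj : j = i
          · exact Eventually.of_forall fun _ h' => absurd hj h'
          · exact (hnhds j x (hi j hj)).mono fun _ h' _ => h'
        exact this.mono fun z hz => hHi i z hz
      have hxT : x - y i ∉ T i := fun h' => hx (Set.mem_iUnion.2 ⟨i, x - y i, h', by simp⟩)
      rw [he.fderiv_eq, he.eq_of_nhds, fderiv_comp_sub_const,
        Finset.sum_eq_single i (fun j _ hj => hF j _ (hi j hj).le)
          fun hi => absurd (Finset.mem_univ i) hi,
        Finset.sum_eq_single i (fun j _ hj => hG j _ (hi j hj).le)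
          fun hi => absurd (Finset.mem_univ i) hi, hg i _ hxT v, gaugeTransform]
  · set S : ℝ := ∑ i, (‖y i‖ + |R i|) with hS
    have hnn : ∀ i, 0 ≤ ‖y i‖ + |R i| := fun i => by positivity
    have hS0 : 0 ≤ S := Finset.sum_nonneg fun i _ => hnn i
    refine ⟨(S + 1)⁻¹, by positivity, fun _ => 1, contDiffOn_const, rfl, fun x hx => ?_⟩
    rw [inv_inv] at hx
    refine hH1 x fun i => ?_
    have h1 : ‖y i‖ + |R i| ≤ S :=
      Finset.single_le_sum (f := fun i => ‖y i‖ + |R i|) (fun i _ => hnn i) (Finset.mem_univ i)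
    linarith [norm_sub_norm_le x (y i), le_abs_self (R i)]

/-! ### The splicing map under reindexing -/

/-- All other fields of the structure are propositions. -/
theorem FramedConnection.eq_of_form_eq {A B : FramedConnection} (hs : A.sing = B.sing)
    (hf : A.form = B.form) : A = B := by
  cases A; cases B; cases hs; cases hf; rfl

theorem CutOff.weight_eq_weight_sub (χ : CutOff) (y : R4) (r : ℝ) (x : R4) :
    χ.weight y r x = χ.weight 0 r (x - y) := by
  simp [CutOff.weight]

theorem CutOff.weight_add (χ : CutOff) (y z : R4) (r : ℝ) (x : R4) :
    χ.weight (y + z) r x = χ.weight z r (x - y) := by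
  simp [CutOff.weight, sub_sub]

/-- No gauge transformation is needed: `parallelRep` is a function of the class and the radius
alone, so the two spliced connections are the same sum and the same union taken in another order. -/
theorem splicingMap_comp_equiv (χ : CutOff) {ι ι' : Type} [Fintype ι] [Fintype ι'] (e : ι ≃ ι')
    {m : ι → ℕ} {m' : ι' → ℕ} {D : SplicingDatum ι} {E : SplicingDatum ι'}
    (hm : ∀ i, m' (e i) = m i) (hpt : ∀ i, E.pt (e i) = D.pt i)
    (hid : ∀ i, E.ideal (e i) = D.ideal i) : splicingMap χ m' E = splicingMap χ m D := by
  obtain rfl : m = fun i => m' (e i) := (funext hm).symm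
  obtain rfl : D = ⟨fun i => E.pt (e i), fun i => E.ideal (e i)⟩ := by
    cases D; congr 1 <;> funext i
    exacts [(hpt i).symm, (hid i).symm]
  set D : SplicingDatum ι := ⟨fun i => E.pt (e i), fun i => E.ideal (e i)⟩
  have hsep : D.Separated (fun i => m' (e i)) ↔ E.Separated m' := by
    constructor
    · intro h i j hij
      simpa [D, SplicingDatum.scale] using h (e.symm i) (e.symm j) (by simpa using hij)
    · intro h i j hij
      exact h (e i) (e j) (by simpa using hij)
  have hpts : (splicingMap χ m' E).pts = (splicingMap χ (fun i => m' (e i)) D).pts :=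
    (Equiv.sum_comp e fun i => (E.ideal i).pts.map fun x => E.pt i + x).symm
  have hconn : (splicingMap χ m' E).conn = (splicingMap χ (fun i => m' (e i)) D).conn := by
    by_cases h : E.Separated m'
    · simp only [splicingMap, dif_pos h, dif_pos (hsep.2 h)]
      refine congrArg _ (FramedConnection.eq_of_form_eq ?_ ?_)
      · exact (e.surjective.iUnion_comp _).symm
      · funext x
        exact (Equiv.sum_comp e fun i => χ.weight (E.pt i) (4 * Real.sqrt (E.scale m' i)) x •
          (parallelRep (E.ideal i).conn (2 * Real.sqrt (E.scale m' i))).form (x - E.pt i)).symm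
    · simp only [splicingMap, dif_neg h, dif_neg (fun h' => h (hsep.1 h'))]
  calc splicingMap χ m' E = ⟨(splicingMap χ m' E).conn, (splicingMap χ m' E).pts⟩ := rfl
    _ = _ := by rw [hpts, hconn]

/-! ### Blocks -/

theorem block_eq_of_subset {κ : ℕ} {P Q : SetPartition κ} {B B' C : Finset (Fin κ)}
    (hB : B ∈ P.parts) (hB' : B' ∈ P.parts) (hC : C ∈ Q.parts) (h : C ⊆ B) (h' : C ⊆ B') :
    B = B' := by
  obtain ⟨i, hi⟩ := Q.nonempty_of_mem_parts hC
  exact P.eq_of_mem_parts hB hB' (h hi) (h' hi)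

theorem subset_parentBlock {κ : ℕ} {P Q : SetPartition κ} (h : Q ≤ P) (C : Q.parts) :
    C.1 ⊆ (parentBlock h C).1 :=
  (h C.2).choose_spec.2

theorem parentBlock_eq {κ : ℕ} {P Q : SetPartition κ} (h : Q ≤ P) {C : Q.parts} {B : P.parts}
    (hCB : C.1 ⊆ B.1) : parentBlock h C = B :=
  Subtype.ext (block_eq_of_subset (parentBlock h C).2 B.2 C.2 (subset_parentBlock h C) hCB)

/-- The blocks of a refinement, sorted by the blocks in which they lie. -/
noncomputable def blocksEquiv {κ : ℕ} {P Q : SetPartition κ} (h : Q ≤ P) :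
    ((B : P.parts) × BlocksIn Q B.1) ≃ Q.parts where
  toFun p := ⟨p.2.1, p.2.2.1⟩
  invFun C := ⟨parentBlock h C, C.1, C.2, subset_parentBlock h C⟩
  left_inv := by
    rintro ⟨B, C, hC, hCB⟩
    obtain rfl := parentBlock_eq h (C := ⟨C, hC⟩) (B := B) hCB
    rfl
  right_inv _ := rfl

theorem sum_blocks {κ : ℕ} {P Q : SetPartition κ} (h : Q ≤ P) {M : Type*} [AddCommMonoid M]
    (f : Q.parts → M) :
    ∑ C, f C = ∑ B : P.parts, ∑ C : BlocksIn Q B.1, f ⟨C.1, C.2.1⟩ := by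
  rw [← Equiv.sum_comp (blocksEquiv h), Fintype.sum_sigma]
  rfl

theorem blocksIn_eq {κ : ℕ} {Q : SetPartition κ} {B : Finset (Fin κ)} (hB : B ∈ Q.parts)
    (C : BlocksIn Q B) : C = ⟨B, hB, subset_rfl⟩ :=
  Subtype.ext (block_eq_of_subset C.2.1 hB C.2.1 subset_rfl C.2.2)

theorem sum_blocksIn_of_mem {κ : ℕ} {Q : SetPartition κ} {B : Finset (Fin κ)} (hB : B ∈ Q.parts)
    {M : Type*} [AddCommMonoid M] (f : BlocksIn Q B → M) :
    ∑ C, f C = f ⟨B, hB, subset_rfl⟩ :=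
  Fintype.sum_eq_single _ fun C hC => absurd (blocksIn_eq hB C) hC

/-- A block common to `P` and `Q` carries a single offset, and mass-centring says that a positive
multiple of it is zero. This is why the downward map can keep the ideal connection untranslated on
such a block. -/
theorem off_eq_zero_of_mem {κ : ℕ} {P Q : SetPartition κ} {a : OverlapDatum P Q} {B : P.parts}
    {δ : ℝ} (ha : (a.fibre B).pt ∈ openDiagonal (blockInCard Q B.1) δ) (hB : B.1 ∈ Q.parts) :
    a.off ⟨B.1, hB⟩ = 0 := by
  have h := ha.2.1
  rw [sum_blocksIn_of_mem hB, ← Nat.cast_smul_eq_nsmul ℝ] at h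
  exact (smul_eq_zero.1 h).resolve_left
    (Nat.cast_ne_zero.2 (Finset.card_pos.2 (Q.nonempty_of_mem_parts hB)).ne')

/-! ### Associativity of splicing -/

/-- The gauge transformation which compares the form spliced in a block with the form of its
parallel representative, cut off in a larger ball. -/
theorem exists_gauge_block (χ : CutOff) {κ : ℕ} {P Q : SetPartition κ} (a : OverlapDatum P Q)
    (B : P.parts)
    (hfib : B.1 ∉ Q.parts → (a.fibre B).Separated (blockInCard Q B.1))
    (hconc : B.1 ∉ Q.parts → ∀ C : BlocksIn Q B.1,
      closure (Metric.ball ((a.fibre B).pt C)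
        (4 * Real.sqrt ((a.fibre B).scale (blockInCard Q B.1) C))) ⊆
      Metric.ball 0 (2 * Real.sqrt ((splicingMap χ (blockInCard Q B.1) (a.fibre B)).scale
        B.1.card)))
    (hoff : ∀ hB : B.1 ∈ Q.parts, a.off ⟨B.1, hB⟩ = 0)
    (F G : OneForm)
    (hF : F = fun x => ∑ C : BlocksIn Q B.1,
      χ.weight ((a.fibre B).pt C)
        (4 * Real.sqrt ((a.fibre B).scale (blockInCard Q B.1) C)) x •
      (parallelRep ((a.fibre B).ideal C).conn
        (2 * Real.sqrt ((a.fibre B).scale (blockInCard Q B.1) C))).form (x - (a.fibre B).pt C))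
    (hG : G = fun x =>
      χ.weight 0 (4 * Real.sqrt ((overlapDown χ a).scale (blockCard P) B)) x •
      (parallelRep ((overlapDown χ a).ideal B).conn
        (2 * Real.sqrt ((overlapDown χ a).scale (blockCard P) B))).form x) :
    ∃ (T : Set R4) (h : R4 → M2), T.Finite ∧
      (∀ C : BlocksIn Q B.1, (fun z => (a.fibre B).pt C + z) ''
        (parallelRep ((a.fibre B).ideal C).conn
          (2 * Real.sqrt ((a.fibre B).scale (blockInCard Q B.1) C))).sing ⊆ T) ∧
      (parallelRep ((overlapDown χ a).ideal B).conn
        (2 * Real.sqrt ((overlapDown χ a).scale (blockCard P) B))).sing ⊆ T ∧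
      (∀ x, 4 * Real.sqrt ((overlapDown χ a).scale (blockCard P) B) ≤ ‖x‖ → F x = 0) ∧
      (∀ x, 4 * Real.sqrt ((overlapDown χ a).scale (blockCard P) B) ≤ ‖x‖ → h x = 1) ∧
      (∀ x, h x ∈ SU2) ∧ ContDiffOn ℝ ∞ h Tᶜ ∧
      ∀ x ∉ T, ∀ v, G x v = gaugeTransform h F x v := by
  -- On a common block there is one cluster, at offset zero and with the same scale on both sides.
  -- The two forms coincide and the constant gauge `1` serves.
  by_cases hB : B.1 ∈ Q.parts
  · have hid : (overlapDown χ a).ideal B = a.ideal ⟨B.1, hB⟩ := dif_pos hB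
    have hsc : (overlapDown χ a).scale (blockCard P) B
        = (a.fibre B).scale (blockInCard Q B.1) ⟨B.1, hB, subset_rfl⟩ := by
      rw [SplicingDatum.scale, hid]; rfl
    have hpt : (a.fibre B).pt ⟨B.1, hB, subset_rfl⟩ = 0 := hoff hB
    have hFG : F = G := by
      rw [hF, hG, hid, hsc]
      funext x
      rw [sum_blocksIn_of_mem hB, hpt, sub_zero]
      rfl
    rw [hid, hsc]
    refine ⟨_, fun _ => 1, FramedConnection.sing_finite _, fun C => ?_, subset_rfl, fun x hx => ?_,
      fun _ _ => rfl, fun _ => one_mem _, contDiffOn_const, fun x _ v => ?_⟩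
    · rw [blocksIn_eq hB C, hpt]
      simp only [zero_add, Set.image_id']
      exact subset_rfl
    · rw [hFG, hG, hsc]
      dsimp only
      rw [χ.weight_eq_zero (by simpa using hx)]
      exact zero_smul ℝ (_ : R4 →L[ℝ] M2)
    · rw [hFG]; simp [gaugeTransform]
  · have hid : (overlapDown χ a).ideal B = splicingMap χ (blockInCard Q B.1) (a.fibre B) :=
      dif_neg hB
    have hsc : (overlapDown χ a).scale (blockCard P) B
        = (splicingMap χ (blockInCard Q B.1) (a.fibre B)).scale B.1.card := by
      rw [SplicingDatum.scale, hid]; rfl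
    rw [hsc] at hG ⊢
    rw [hid] at hG ⊢
    set r := 2 * Real.sqrt ((splicingMap χ (blockInCard Q B.1) (a.fibre B)).scale B.1.card) with hr
    have hr4 : 4 * Real.sqrt ((splicingMap χ (blockInCard Q B.1) (a.fibre B)).scale B.1.card)
        = 2 * r := by rw [hr]; ring
    have hr0 : 0 ≤ r := by positivity
    rw [hr4] at hG ⊢
    set A := spliceConnections χ (a.fibre B).pt ((a.fibre B).scale (blockInCard Q B.1))
      (fun C => parallelRep ((a.fibre B).ideal C).conn
        (2 * Real.sqrt ((a.fibre B).scale (blockInCard Q B.1) C)))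
      (fun _ => parallelRep_isParallelOutside _ _) (hfib hB) with hA
    have hAF : A.form = F := hF.symm
    have hconn : (splicingMap χ (blockInCard Q B.1) (a.fibre B)).conn = ⟦A⟧ := dif_pos (hfib hB)
    -- Concentration places the support of every inner summand in `B(0, r)`, where `r = 2√λ` is half
    -- the radius of the outer cut-off.
    have hvan : ∀ x, r ≤ ‖x‖ → A.form x = 0 := by
      intro x hx
      rw [hAF, hF]
      refine Finset.sum_eq_zero fun C _ => ?_
      rw [χ.weight_eq_zero]
      · exact zero_smul ℝ (_ : R4 →L[ℝ] M2)
      by_contra hlt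
      rw [not_le, ← mem_ball_iff_norm] at hlt
      have := hconc hB C (subset_closure hlt)
      rw [mem_ball_zero_iff] at this
      linarith
    have hsing : A.sing ⊆ Metric.ball 0 r := by
      refine Set.iUnion_subset fun C => ?_
      rintro _ ⟨z, hz, rfl⟩
      refine hconc hB C (subset_closure ?_)
      have := (parallelRep_isParallelOutside _ _).1 hz
      rw [mem_ball_zero_iff] at this
      rw [mem_ball_iff_norm, add_sub_cancel_left]
      linarith [Real.sqrt_nonneg ((a.fibre B).scale (blockInCard Q B.1) C)]
    -- Vanishing outside the ball makes `A` itself parallel there. Hence `parallelRep` takes its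
    -- first branch and really represents the class of `A`.
    have hex : ∃ A' : FramedConnection, (⟦A'⟧ : FramedClass) = ⟦A⟧ ∧ A'.IsParallelOutside r :=
      ⟨A, rfl, hsing, fun x hx => by rw [hvan x hx]; rfl⟩
    rw [hconn] at hG ⊢
    have hrep : GaugeEquivalent A (parallelRep ⟦A⟧ r) := by
      refine (Quotient.exact (s := FramedConnection.setoid) (?_ : _ = _) :
        GaugeEquivalent (parallelRep ⟦A⟧ r) A).symm
      rw [parallelRep, dif_pos hex]
      exact hex.choose_spec.1
    obtain ⟨hA', T, h, hT, hAT, hAT', hm, hs, hg, hone⟩ :=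
      hrep.exists_gauge_eq_one hvan (parallelRep_isParallelOutside _ _)
    -- The outer cut-off is `1` for `‖x‖ < r`, and beyond that radius the representative is zero by
    -- rigidity, so cutting off changes nothing.
    have hGform : G = (parallelRep ⟦A⟧ r).form := by
      rw [hG]
      funext x
      rcases lt_or_ge ‖x‖ r with hx | hx
      · rw [χ.weight_eq_one (by simpa using hx)]
        exact one_smul ℝ (_ : R4 →L[ℝ] M2)
      · rw [hA' x hx]
        exact smul_zero (A := R4 →L[ℝ] M2) (χ.weight 0 (2 * r) x)
    refine ⟨T, h, hT, fun C => (Set.subset_iUnion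
      (fun C : BlocksIn Q B.1 => (fun z => (a.fibre B).pt C + z) ''
        (parallelRep ((a.fibre B).ideal C).conn
          (2 * Real.sqrt ((a.fibre B).scale (blockInCard Q B.1) C))).sing) C).trans hAT, hAT',
      fun x hx => ?_, fun x hx => hone x (by linarith), hm, hs, ?_⟩
    · rw [← hAF]; exact hvan x (by linarith)
    · rw [hGform, ← hAF]; exact hg

/-- Splicing at the points of a refinement is splicing in the blocks, followed by splicing the
results. -/
theorem splicingMap_overlapUp (χ : CutOff) {κ : ℕ} {P Q : SetPartition κ} (h : Q ≤ P)
    (a : OverlapDatum P Q)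
    (hup : (overlapUp h a).Separated (blockCard Q))
    (hdown : (overlapDown χ a).Separated (blockCard P))
    (hfib : ∀ B : P.parts, B.1 ∉ Q.parts → (a.fibre B).Separated (blockInCard Q B.1))
    (hconc : ∀ B : P.parts, B.1 ∉ Q.parts → ∀ C : BlocksIn Q B.1,
      closure (Metric.ball ((a.fibre B).pt C)
        (4 * Real.sqrt ((a.fibre B).scale (blockInCard Q B.1) C))) ⊆
      Metric.ball 0 (2 * Real.sqrt ((splicingMap χ (blockInCard Q B.1) (a.fibre B)).scale
        B.1.card)))
    (hoff : ∀ (B : P.parts) (hB : B.1 ∈ Q.parts), a.off ⟨B.1, hB⟩ = 0) :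
    splicingMap χ (blockCard Q) (overlapUp h a) = splicingMap χ (blockCard P) (overlapDown χ a) := by
  have hpar : ∀ (B : P.parts) (C : BlocksIn Q B.1), parentBlock h ⟨C.1, C.2.1⟩ = B :=
    fun B C => parentBlock_eq h C.2.2
  have hpts : (splicingMap χ (blockCard Q) (overlapUp h a)).pts =
      (splicingMap χ (blockCard P) (overlapDown χ a)).pts := by
    refine (sum_blocks h _).trans (Finset.sum_congr rfl fun B _ => ?_)
    by_cases hB : B.1 ∈ Q.parts
    · have hid : (overlapDown χ a).ideal B = a.ideal ⟨B.1, hB⟩ := dif_pos hB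
      rw [sum_blocksIn_of_mem hB, hid]
      simp only [overlapUp, hpar B ⟨B.1, hB, subset_rfl⟩, hoff B hB, add_zero]
      rfl
    · have hid : (overlapDown χ a).ideal B = splicingMap χ (blockInCard Q B.1) (a.fibre B) :=
        dif_neg hB
      rw [hid]
      simp only [splicingMap, overlapUp, hpar B]
      -- Translation by the base point is additive on multisets, which reduces the claim to
      -- composing two translations.
      rw [← Multiset.coe_mapAddMonoidHom, map_sum]
      refine Finset.sum_congr rfl fun C _ => ?_
      rw [Multiset.coe_mapAddMonoidHom, Multiset.map_map]
      refine Multiset.map_congr rfl fun x _ => ?_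
      exact add_assoc _ _ _
  have hconn : (splicingMap χ (blockCard Q) (overlapUp h a)).conn =
      (splicingMap χ (blockCard P) (overlapDown χ a)).conn := by
    simp only [splicingMap, dif_pos hup, dif_pos hdown]
    refine Quotient.sound ?_
    choose T g hT hTQ hTP hF hone hm hs hg using fun B : P.parts =>
      exists_gauge_block χ a B (hfib B) (hconc B) (hoff B) _ _ rfl rfl
    refine GaugeEquivalent.glue a.base
      (fun B => 4 * Real.sqrt ((overlapDown χ a).scale (blockCard P) B)) _ _ T g
      (fun i j hij => ?_) hF (fun B x hx => ?_) hT hm hs hg hone (fun x => ?_) (fun x => ?_) ?_ ?_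
    -- Gluing needs disjoint balls of radius `4√λ`; separation provides twice that distance.
    · have := hdown i j hij
      have h1 := Real.sqrt_nonneg ((overlapDown χ a).scale (blockCard P) i)
      have h2 := Real.sqrt_nonneg ((overlapDown χ a).scale (blockCard P) j)
      exact lt_of_le_of_lt (by linarith) this
    · rw [χ.weight_eq_zero (by simpa using hx)]
      exact zero_smul ℝ (_ : R4 →L[ℝ] M2)
    · refine (sum_blocks h _).trans (Finset.sum_congr rfl fun B _ =>
        Finset.sum_congr rfl fun C _ => ?_)
      simp only [overlapUp, hpar B C]
      rw [χ.weight_add, ← sub_sub]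
      rfl
    · refine Finset.sum_congr rfl fun B _ => ?_
      rw [χ.weight_eq_weight_sub]
      rfl
    · refine Set.iUnion_subset fun C => ?_
      rintro _ ⟨z, hz, rfl⟩
      refine Set.mem_iUnion.2 ⟨parentBlock h C, a.off C + z,
        hTQ _ ⟨C.1, C.2, subset_parentBlock h C⟩ ⟨z, hz, rfl⟩, ?_⟩
      exact (add_assoc _ _ _).symm
    · exact Set.iUnion_mono fun B => Set.image_mono (hTP B)
  calc splicingMap χ (blockCard Q) (overlapUp h a)
      = ⟨(splicingMap χ (blockCard Q) (overlapUp h a)).conn,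
        (splicingMap χ (blockCard Q) (overlapUp h a)).pts⟩ := rfl
    _ = _ := by rw [hpts, hconn]

theorem splicingMap_overlapUp_of_mem (χ : CutOff) {κ : ℕ} {P Q : SetPartition κ} (h : Q ≤ P)
    {δ : ℝ} {d e : ℕ → ℝ} {a : OverlapDatum P Q} (ha : a ∈ overlapDomain χ h δ d e) :
    splicingMap χ (blockCard Q) (overlapUp h a) = splicingMap χ (blockCard P) (overlapDown χ a) :=
  splicingMap_overlapUp χ h a ha.2.2.1.2.2.1 ha.2.2.2.2.2.2.1
    (fun B hB => (ha.2.2.2.1 B hB).1.2.2.1) (fun B hB C => ((ha.2.2.2.1 B hB).2 C).1)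
    fun B hB => off_eq_zero_of_mem (ha.1.2.1 B) hB

/-! ### Ideal connections with trivial background -/

theorem curvatureComp_trivialConnection (x : R4) (i j : Fin 4) :
    curvatureComp trivialConnection.form x i j = 0 := by
  have h : fderiv ℝ trivialConnection.form x = 0 :=
    fderiv_const_apply (0 : R4 →L[ℝ] M2)
  simp only [curvatureComp, curvature, h]
  simp [trivialConnection]

theorem charge_trivialConnection : FramedClass.charge ⟦trivialConnection⟧ = 0 := by
  simp [FramedClass.charge, chernDensity, curvatureComp_trivialConnection]

theorem firstMoment_trivialConnection : FramedClass.firstMoment ⟦trivialConnection⟧ = 0 := by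
  simp [FramedClass.firstMoment, energyDensity, curvatureComp_trivialConnection]

theorem secondMoment_trivialConnection (z : R4) :
    FramedClass.secondMoment z ⟦trivialConnection⟧ = 0 := by
  simp [FramedClass.secondMoment, energyDensity, curvatureComp_trivialConnection]

/-- The points `y i`, with multiplicities `m i`, on the trivial connection. -/
noncomputable def clusterIdeal {ι : Type} [Fintype ι] (m : ι → ℕ) (y : ι → R4) : IdealConnection :=
  ⟨⟦trivialConnection⟧, ∑ i, Multiset.replicate (m i) (y i)⟩

theorem clusterIdeal_center {ι : Type} [Fintype ι] (m : ι → ℕ) (y : ι → R4)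
    (hy : ∑ i, m i • y i = 0) (k : ℕ) : (clusterIdeal m y).center k = 0 := by
  have : (∑ i, Multiset.replicate (m i) (y i)).sum = 0 := by
    rw [← Multiset.coe_sumAddMonoidHom, map_sum]
    simpa using hy
  simp [IdealConnection.center, clusterIdeal, firstMoment_trivialConnection, this]

theorem clusterIdeal_scale {ι : Type} [Fintype ι] (m : ι → ℕ) (y : ι → R4)
    (hy : ∑ i, m i • y i = 0) (k : ℕ) :
    (clusterIdeal m y).scale k = Real.sqrt (∑ i, m i * ‖y i‖ ^ 2) := by
  have h : ((∑ i, Multiset.replicate (m i) (y i)).map fun x => ‖x‖ ^ 2).sum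
      = ∑ i, (m i : ℝ) * ‖y i‖ ^ 2 := by
    rw [← Multiset.coe_mapAddMonoidHom, map_sum, ← Multiset.coe_sumAddMonoidHom, map_sum]
    refine Finset.sum_congr rfl fun i _ => ?_
    simp
  rw [IdealConnection.scale, clusterIdeal_center m y hy]
  simp only [clusterIdeal, secondMoment_trivialConnection, sub_zero, h, mul_zero, zero_add]

theorem clusterIdeal_mem_idealSpace {ι : Type} [Fintype ι] {m : ι → ℕ} {y : ι → R4}
    (hy : ∑ i, m i • y i = 0) {k : ℕ} (hk : ∑ i, m i = k) {ε : ℝ}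
    (hε : Real.sqrt (∑ i, m i * ‖y i‖ ^ 2) ≤ ε) : clusterIdeal m y ∈ idealSpace k ε := by
  have hcard : (clusterIdeal m y).pts.card = k := by
    simp [← hk, clusterIdeal, Multiset.card_sum]
  refine ⟨hcard.le, ?_, ?_⟩
  · rw [hcard, sub_self]; exact charge_trivialConnection
  · rwa [clusterIdeal_scale m y hy]

/-- Viewing the cone point as a one-point cluster lets its scale and membership follow from the
cluster computations. -/
theorem coneIdeal_eq_clusterIdeal (k : ℕ) :
    coneIdeal k = clusterIdeal (fun _ : Unit => k) fun _ => 0 := by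
  simp [coneIdeal, clusterIdeal]

theorem coneIdeal_scale (k l : ℕ) : (coneIdeal k).scale l = 0 := by
  rw [coneIdeal_eq_clusterIdeal, clusterIdeal_scale _ _ (by simp)]
  simp

theorem coneIdeal_mem_idealSpace (k : ℕ) {ε : ℝ} (hε : 0 ≤ ε) : coneIdeal k ∈ idealSpace k ε := by
  rw [coneIdeal_eq_clusterIdeal]
  exact clusterIdeal_mem_idealSpace (by simp) (by simp) (by simpa using hε)

section Cone

variable (χ : CutOff) {ι : Type} {m : ι → ℕ} {D : SplicingDatum ι}

theorem SplicingDatum.scale_of_cone (hD : ∀ i, D.ideal i = coneIdeal (m i)) (i : ι) :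
    D.scale m i = 0 := by
  rw [SplicingDatum.scale, hD, coneIdeal_scale]

theorem SplicingDatum.separated_of_cone (hD : ∀ i, D.ideal i = coneIdeal (m i))
    (hinj : Function.Injective D.pt) : D.Separated m := by
  intro i j hij
  rw [scale_of_cone hD, scale_of_cone hD]
  simpa using hinj.ne hij

/-- All radii are zero, so every weight vanishes and every singular set lies in an empty ball. The
spliced connection is the trivial one whatever representatives were chosen. -/
theorem splicingMap_of_cone [Fintype ι] (hD : ∀ i, D.ideal i = coneIdeal (m i))
    (hinj : Function.Injective D.pt) : splicingMap χ m D = clusterIdeal m D.pt := by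
  have hsc := SplicingDatum.scale_of_cone hD
  have hpts : (splicingMap χ m D).pts = (clusterIdeal m D.pt).pts := by
    refine Finset.sum_congr rfl fun i _ => ?_
    rw [hD i]
    simp [coneIdeal]
  have hconn : (splicingMap χ m D).conn = (clusterIdeal m D.pt).conn := by
    simp only [splicingMap, dif_pos (SplicingDatum.separated_of_cone hD hinj), clusterIdeal]
    refine congrArg _ (FramedConnection.eq_of_form_eq ?_ ?_)
    · refine Set.eq_empty_of_subset_empty (Set.iUnion_subset fun i => ?_)
      rintro _ ⟨z, hz, -⟩
      have := (parallelRep_isParallelOutside _ _).1 hz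
      rw [hsc i] at this
      simp at this
    · funext x
      refine Finset.sum_eq_zero fun i _ => ?_
      rw [hsc i, χ.weight_eq_zero (by simp)]
      exact zero_smul ℝ (_ : R4 →L[ℝ] M2)
  calc splicingMap χ m D = ⟨(splicingMap χ m D).conn, (splicingMap χ m D).pts⟩ := rfl
    _ = _ := by rw [hpts, hconn]

theorem mem_splicingDomain_of_cone [Fintype ι] (hD : ∀ i, D.ideal i = coneIdeal (m i)) {k : ℕ}
    (hk : ∑ i, m i = k) {δ : ℝ} (hδ : 0 < δ) (hpt : D.pt ∈ openDiagonal m δ) {e : ℕ → ℝ}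
    (he : ∀ k, 0 < e k) : D ∈ splicingDomain χ m k δ e := by
  refine ⟨hpt, fun i => ?_, SplicingDatum.separated_of_cone hD hpt.1, ?_⟩
  · rw [hD i]; exact coneIdeal_mem_idealSpace _ (he _).le
  · rw [splicingMap_of_cone χ hD hpt.1]
    exact clusterIdeal_mem_idealSpace hpt.2.1 hk (hpt.2.2.le.trans (by linarith))

/-- The balls to be enclosed have radius zero, hence are empty. -/
theorem mem_concentratedDomain_of_cone [Fintype ι] (hD : ∀ i, D.ideal i = coneIdeal (m i)) {k : ℕ}
    (hk : ∑ i, m i = k) {δ : ℝ} (hδ : 0 < δ) (hpt : D.pt ∈ openDiagonal m δ) {e : ℕ → ℝ}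
    (he : ∀ k, 0 < e k) : D ∈ concentratedDomain χ m k δ e := by
  refine ⟨mem_splicingDomain_of_cone χ hD hk hδ hpt he, fun i => ?_⟩
  rw [SplicingDatum.scale_of_cone hD, Real.zero_rpow (by norm_num)]
  simp

end Cone

/-! ### Overlap data near the trivial stratum -/

theorem sum_blockCard {κ : ℕ} (P : SetPartition κ) : ∑ B, blockCard P B = κ := by
  have := P.sum_card_parts
  rw [Finset.card_univ, Fintype.card_fin] at this
  exact (Finset.sum_coe_sort P.parts Finset.card).trans this

theorem sum_blockInCard {κ : ℕ} {P Q : SetPartition κ} (h : Q ≤ P) (B : P.parts) :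
    ∑ C, blockInCard Q B.1 C = B.1.card := by
  have hB : (Finset.univ : Finset (BlocksIn Q B.1)).biUnion (fun C => C.1) = B.1 := by
    ext i
    simp only [Finset.mem_biUnion, Finset.mem_univ, true_and]
    constructor
    · rintro ⟨C, hi⟩; exact C.2.2 hi
    · intro hi
      obtain ⟨C, hC, hiC⟩ := Q.exists_mem (Finset.mem_univ i)
      obtain ⟨B', hB', hCB'⟩ := h hC
      obtain rfl := P.eq_of_mem_parts hB' B.2 (hCB' hiC) hi
      exact ⟨⟨C, hC, hCB'⟩, hiC⟩
  conv_rhs => rw [← hB]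
  rw [Finset.card_biUnion]
  · rfl
  · intro C _ C' _ hne
    exact Q.disjoint C.2.1 C'.2.1 fun h' => hne (Subtype.ext h')

/-- The scale of a configuration of points in the block `B`. -/
noncomputable def blockScale {κ : ℕ} {P : SetPartition κ} (Q : SetPartition κ) (x : Q.parts → R4)
    (B : P.parts) : ℝ :=
  Real.sqrt (∑ C : BlocksIn Q B.1, blockInCard Q B.1 C * ‖x ⟨C.1, C.2.1⟩‖ ^ 2)

theorem continuous_blockScale {κ : ℕ} {P : SetPartition κ} (Q : SetPartition κ) (B : P.parts) :
    Continuous fun x : Q.parts → R4 => blockScale Q x B := by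
  unfold blockScale
  fun_prop

/-- Configurations for which the clusters of different blocks of `P` remain apart. -/
def apartConfigurations {κ : ℕ} {P Q : SetPartition κ} (h : Q ≤ P) (δ : ℝ) :
    Set ((P.parts → R4) × (Q.parts → R4)) :=
  {p | (∀ B B', B ≠ B' → 8 * Real.sqrt (blockScale Q p.2 B) + 8 * Real.sqrt (blockScale Q p.2 B')
      < dist (p.1 B) (p.1 B')) ∧
    (∀ C C', parentBlock h C ≠ parentBlock h C' →
      p.1 (parentBlock h C) + p.2 C ≠ p.1 (parentBlock h C') + p.2 C') ∧
    Real.sqrt (∑ C, blockCard Q C * ‖p.1 (parentBlock h C) + p.2 C‖ ^ 2) < δ}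

theorem isOpen_apartConfigurations {κ : ℕ} {P Q : SetPartition κ} (h : Q ≤ P) (δ : ℝ) :
    IsOpen (apartConfigurations h δ) := by
  have hforall : ∀ {ι : Type} [Finite ι] (r : ι → ι → Prop)
      {p : ι → ι → (P.parts → R4) × (Q.parts → R4) → Prop},
      (∀ i j, IsOpen {x | p i j x}) → IsOpen {x | ∀ i j, r i j → p i j x} := by
    intro ι _ r p hp
    have : {x | ∀ i j, r i j → p i j x} = ⋂ i, ⋂ j, ⋂ _ : r i j, {x | p i j x} := by ext; simp
    rw [this]
    exact isOpen_iInter_of_finite fun i => isOpen_iInter_of_finite fun j =>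
      isOpen_iInter_of_finite fun _ => hp i j
  have hs : ∀ B : P.parts, Continuous fun p : (P.parts → R4) × (Q.parts → R4) =>
      blockScale Q p.2 B := fun B => (continuous_blockScale Q B).comp continuous_snd
  have hsplit : ∀ p q r : (P.parts → R4) × (Q.parts → R4) → Prop, IsOpen {x | p x} →
      IsOpen {x | q x} → IsOpen {x | r x} → IsOpen {x | p x ∧ q x ∧ r x} :=
    fun _ _ _ hp hq hr => hp.and (hq.and hr)
  refine hsplit _ _ _ (hforall _ fun B B' => ?_)
    (hforall _ fun C C' => ?_) ?_
  · exact isOpen_lt (((hs B).sqrt.const_mul 8).add ((hs B').sqrt.const_mul 8)) (by fun_prop)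
  · exact isOpen_ne_fun (by fun_prop) (by fun_prop)
  · exact isOpen_lt (by fun_prop) continuous_const

/-- The sizes of the blocks of `Q` in a block of `P` add up to its size. Applied to `y` this
transfers mass-centring, and applied to `‖y‖²` the scale. -/
theorem sum_blocks_base {κ : ℕ} {P Q : SetPartition κ} (h : Q ≤ P) {M : Type*} [AddCommMonoid M]
    (f : P.parts → M) :
    ∑ C, blockCard Q C • f (parentBlock h C) = ∑ B, blockCard P B • f B := by
  rw [sum_blocks h]
  refine Finset.sum_congr rfl fun B _ => ?_
  rw [blockCard, ← sum_blockInCard h B, Finset.sum_smul]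
  refine Finset.sum_congr rfl fun C _ => ?_
  rw [parentBlock_eq h (C := ⟨C.1, C.2.1⟩) C.2.2]
  rfl

theorem mem_apartConfigurations {κ : ℕ} {P Q : SetPartition κ} (h : Q ≤ P) {δ : ℝ}
    {y : P.parts → R4} (hy : y ∈ openDiagonal (blockCard P) δ) :
    (y, 0) ∈ apartConfigurations h δ := by
  refine ⟨fun B B' hB => ?_, fun C C' hC => ?_, ?_⟩
  · simpa [blockScale] using hy.1.ne hB
  · simpa using hy.1.ne hC
  · have h1 := sum_blocks_base h fun B => ‖y B‖ ^ 2
    have h2 := hy.2.2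
    simp only [nsmul_eq_mul] at h1
    simp only [Pi.zero_apply, add_zero]
    rwa [h1]

/-- Points over different blocks of `P` are distinct by apartness, those over the same block by
injectivity in the fibre; the centres of mass of the fibres contribute nothing to the total. -/
theorem overlapUp_mem_openDiagonal {κ : ℕ} {P Q : SetPartition κ} (h : Q ≤ P) {δ : ℝ} {d e : ℕ → ℝ}
    {a : OverlapDatum P Q} (ha : a ∈ overlapSpace P Q δ d e)
    (hN : (a.base, a.off) ∈ apartConfigurations h δ) :
    (overlapUp h a).pt ∈ openDiagonal (blockCard Q) δ := by
  refine ⟨fun C C' hCC => ?_, ?_, hN.2.2⟩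
  · have hp : parentBlock h C = parentBlock h C' := by
      by_contra hne
      exact hN.2.1 C C' hne hCC
    have hoff : a.off C = a.off C' := by
      simp only [overlapUp, hp] at hCC
      exact add_left_cancel hCC
    have := (ha.2.1 (parentBlock h C)).1
      (a₁ := ⟨C.1, C.2, subset_parentBlock h C⟩)
      (a₂ := ⟨C'.1, C'.2, hp ▸ subset_parentBlock h C'⟩) hoff
    exact Subtype.ext (Subtype.mk_eq_mk.1 this)
  · simp only [overlapUp, smul_add, Finset.sum_add_distrib]
    rw [sum_blocks_base h, ha.1.2.1, zero_add, sum_blocks h]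
    exact Finset.sum_eq_zero fun B _ => (ha.2.1 B).2.1

/-- All trivial data over apart configurations are in the overlap domain. -/
theorem mem_overlapDomain_of_cone (χ : CutOff) {κ : ℕ} {P Q : SetPartition κ} (h : Q ≤ P) {δ : ℝ}
    (hδ : 0 < δ) {d e : ℕ → ℝ} (hd : ∀ k, 0 < d k) (he : ∀ k, 0 < e k)
    {a : OverlapDatum P Q} (ha : a ∈ overlapSpace P Q δ d e)
    (hN : (a.base, a.off) ∈ apartConfigurations h δ)
    (hcone : ∀ C, a.ideal C = coneIdeal C.1.card) : a ∈ overlapDomain χ h δ d e := by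
  have hup := overlapUp_mem_openDiagonal h ha hN
  have hupD : overlapUp h a ∈ splicingDomain χ (blockCard Q) κ δ e :=
    mem_splicingDomain_of_cone χ hcone (sum_blockCard Q) hδ hup he
  have hfc : ∀ (B : P.parts) C, (a.fibre B).ideal C = coneIdeal (blockInCard Q B.1 C) :=
    fun B C => hcone _
  have hfib : ∀ B : P.parts, a.fibre B ∈
      concentratedDomain χ (blockInCard Q B.1) B.1.card (d B.1.card) e := fun B =>
    mem_concentratedDomain_of_cone χ (hfc B) (sum_blockInCard h B) (hd _) (ha.2.1 B) he
  -- The downward scale is zero on a common block and equals `blockScale` otherwise. Apartness is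
  -- phrased with `blockScale` so as to bound both cases.
  have hdown : ∀ B, (overlapDown χ a).ideal B ∈ idealSpace B.1.card (d B.1.card) ∧
      (overlapDown χ a).scale (blockCard P) B ≤ blockScale Q a.off B := by
    intro B
    rw [SplicingDatum.scale]
    by_cases hB : B.1 ∈ Q.parts
    · have hid : (overlapDown χ a).ideal B = coneIdeal B.1.card := (dif_pos hB).trans (hcone _)
      rw [hid, coneIdeal_scale]
      exact ⟨coneIdeal_mem_idealSpace _ (hd _).le, Real.sqrt_nonneg _⟩
    · have hid : (overlapDown χ a).ideal B = clusterIdeal (blockInCard Q B.1) (a.fibre B).pt :=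
        (dif_neg hB).trans (splicingMap_of_cone χ (hfc B) (ha.2.1 B).1)
      rw [hid, clusterIdeal_scale _ _ (ha.2.1 B).2.1]
      exact ⟨clusterIdeal_mem_idealSpace (ha.2.1 B).2.1 (sum_blockInCard h B) (ha.2.1 B).2.2.le,
        le_rfl⟩
  have hsep : (overlapDown χ a).Separated (blockCard P) := by
    intro B B' hB
    refine lt_of_le_of_lt ?_ (hN.1 B B' hB)
    have h1 := Real.sqrt_le_sqrt (hdown B).2
    have h2 := Real.sqrt_le_sqrt (hdown B').2
    dsimp only
    linarith
  refine ⟨ha, hup, hupD, fun B _ => hfib B, ha.1, fun B => (hdown B).1, hsep, ?_⟩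
  -- The remaining condition, scale at most `2δ` after splicing the downward image, is inherited
  -- from the upward image through associativity.
  rw [← splicingMap_overlapUp χ h a hupD.2.2.1 hsep (fun B _ => (hfib B).1.2.2.1)
    (fun B _ C => ((hfib B).2 C).1) fun B hB => off_eq_zero_of_mem (ha.2.1 B) hB]
  exact hupD.2.2.2

/-! ### Actions of the symmetric group -/

theorem card_map_perm {κ : ℕ} (σ : Equiv.Perm (Fin κ)) (B : Finset (Fin κ)) :
    (B.map σ.toEmbedding).card = B.card :=
  Finset.card_map _

theorem Carries.map_mem_iff {κ : ℕ} {σ : Equiv.Perm (Fin κ)} {P Q : SetPartition κ}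
    (h : Carries σ P Q) {B : Finset (Fin κ)} : B.map σ.toEmbedding ∈ Q.parts ↔ B ∈ P.parts := by
  unfold Carries at h
  rw [h, Finset.mem_image]
  constructor
  · rintro ⟨B', hB', hBB⟩
    rwa [← Finset.map_injective _ hBB]
  · exact fun hB => ⟨B, hB, rfl⟩

theorem Carries.exists_map_eq {κ : ℕ} {σ : Equiv.Perm (Fin κ)} {P Q : SetPartition κ}
    (h : Carries σ P Q) {C : Finset (Fin κ)} (hC : C ∈ Q.parts) :
    ∃ B ∈ P.parts, B.map σ.toEmbedding = C := by
  unfold Carries at h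
  rwa [h, Finset.mem_image] at hC

/-- The bijection of blocks given by a permutation which takes one partition to another. -/
noncomputable def Carries.equiv {κ : ℕ} {σ : Equiv.Perm (Fin κ)} {P Q : SetPartition κ}
    (h : Carries σ P Q) : P.parts ≃ Q.parts :=
  Equiv.ofBijective (fun B => ⟨B.1.map σ.toEmbedding, h.map_mem_iff.2 B.2⟩)
    ⟨fun _ _ hB => Subtype.ext (Finset.map_injective _ (congrArg Subtype.val hB)), fun C => by
      obtain ⟨B, hB, hBC⟩ := h.exists_map_eq C.2
      exact ⟨⟨B, hB⟩, Subtype.ext hBC⟩⟩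

/-- The bijection of the blocks contained in a set with those contained in its image. -/
noncomputable def Carries.equivIn {κ : ℕ} {σ : Equiv.Perm (Fin κ)} {P Q : SetPartition κ}
    (h : Carries σ P Q) (B : Finset (Fin κ)) : BlocksIn P B ≃ BlocksIn Q (B.map σ.toEmbedding) :=
  Equiv.ofBijective
    (fun C => ⟨C.1.map σ.toEmbedding, h.map_mem_iff.2 C.2.1, Finset.map_subset_map.2 C.2.2⟩)
    ⟨fun _ _ hC => Subtype.ext (Finset.map_injective _ (congrArg Subtype.val hC)), fun C => by
      obtain ⟨C', hC', hCC⟩ := h.exists_map_eq C.2.1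
      exact ⟨⟨C', hC', Finset.map_subset_map.1 (hCC ▸ C.2.2)⟩, Subtype.ext hCC⟩⟩

theorem splicingMap_eq_of_moves (χ : CutOff) {κ : ℕ} {P Q : SetPartition κ}
    {σ : Equiv.Perm (Fin κ)} {D : SplicingDatum P.parts} {E : SplicingDatum Q.parts}
    (h : SplicingDatum.Moves σ D E) :
    splicingMap χ (blockCard P) D = splicingMap χ (blockCard Q) E :=
  (splicingMap_comp_equiv χ h.1.equiv (fun B => card_map_perm σ B.1)
    (fun B => (h.2 B _ rfl).1) fun B => (h.2 B _ rfl).2).symm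

theorem OverlapDatum.Moves.overlapUp {κ : ℕ} {P Q R : SetPartition κ} {σ : Equiv.Perm (Fin κ)}
    {a : OverlapDatum P Q} {b : OverlapDatum P R} (h : OverlapDatum.Moves σ a b) (hQ : Q ≤ P)
    (hR : R ≤ P) : SplicingDatum.Moves σ (overlapUp hQ a) (overlapUp hR b) := by
  refine ⟨h.2.1, fun B C hC => ⟨?_, (h.2.2.2 B C hC).2⟩⟩
  have hpar : parentBlock hR C = h.1.equiv (parentBlock hQ B) := by
    refine parentBlock_eq hR ?_
    rw [hC]
    exact Finset.map_subset_map.2 (subset_parentBlock hQ B)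
  simp only [_root_.overlapUp]
  rw [hpar, h.2.2.1 (parentBlock hQ B) _ rfl, (h.2.2.2 B C hC).1]

theorem OverlapDatum.Moves.overlapDown (χ : CutOff) {κ : ℕ} {P Q R : SetPartition κ}
    {σ : Equiv.Perm (Fin κ)} {a : OverlapDatum P Q} {b : OverlapDatum P R}
    (h : OverlapDatum.Moves σ a b) :
    SplicingDatum.Moves σ (overlapDown χ a) (overlapDown χ b) := by
  refine ⟨h.1, fun B C hC => ⟨h.2.2.1 B C hC, ?_⟩⟩
  obtain ⟨C, hCP⟩ := C
  subst hC
  -- Since `σ` carries `Q` to `R`, a block and its image fall in the same branch of the downward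
  -- map.
  by_cases hB : B.1 ∈ Q.parts
  · have hB' : B.1.map σ.toEmbedding ∈ R.parts := h.2.1.map_mem_iff.2 hB
    simp only [_root_.overlapDown, dif_pos hB, dif_pos hB']
    exact (h.2.2.2 ⟨B.1, hB⟩ ⟨_, hB'⟩ rfl).2
  · have hB' : B.1.map σ.toEmbedding ∉ R.parts := fun h' => hB (h.2.1.map_mem_iff.1 h')
    simp only [_root_.overlapDown, dif_neg hB, dif_neg hB']
    exact splicingMap_comp_equiv χ (h.2.1.equivIn B.1) (fun C => card_map_perm σ C.1)
      (fun C => (h.2.2.2 ⟨C.1, C.2.1⟩ ⟨_, h.2.1.map_mem_iff.2 C.2.1⟩ rfl).1)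
      fun C => (h.2.2.2 ⟨C.1, C.2.1⟩ ⟨_, h.2.1.map_mem_iff.2 C.2.1⟩ rfl).2

/-! ### The maps of quotients -/

/-- The splicing map on a quotient of its domain. -/
noncomputable def SplicingQuotient.splice {χ : CutOff} {κ : ℕ} {P : SetPartition κ} {δ : ℝ}
    {d : ℕ → ℝ} : SplicingQuotient χ P δ d → idealSpace κ (2 * δ) :=
  Quot.lift (fun D => ⟨splicingMap χ (blockCard P) D.1, D.2.2.2.2⟩) fun _ _ ⟨_, h⟩ =>
    Subtype.ext (splicingMap_eq_of_moves χ h)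

/-- The splicing map on the quotient of the disjoint union over conjugate refinements. -/
noncomputable def UpperQuotient.splice {χ : CutOff} {κ : ℕ} {P P' : SetPartition κ} {δ : ℝ}
    {e : ℕ → ℝ} : UpperQuotient χ P P' δ e → idealSpace κ (2 * δ) :=
  Quot.lift (fun u => u.2.splice) fun u v ⟨_, _, D, E, hD, hE, h⟩ => by
    rw [hD, hE]
    exact Subtype.ext (splicingMap_eq_of_moves χ h)

/-- The map of quotients induced by the upwards overlap map. -/
noncomputable def OverlapQuotient.up {χ : CutOff} {κ : ℕ} {P P' : SetPartition κ} {δ : ℝ}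
    {d e : ℕ → ℝ} : OverlapQuotient χ P P' δ d e → UpperQuotient χ P P' δ e :=
  Quot.lift (fun u => UpperQuotient.mk u.1 ⟨overlapUp u.1.2.2 u.2.1, u.2.2.2.2.1⟩)
    fun u v ⟨σ, h⟩ => Quot.sound ⟨σ, h.1, ⟨overlapUp u.1.2.2 u.2.1, u.2.2.2.2.1⟩,
      ⟨overlapUp v.1.2.2 v.2.1, v.2.2.2.2.1⟩, rfl, rfl, h.overlapUp u.1.2.2 v.1.2.2⟩

/-- The map of quotients induced by the downwards overlap map. -/
noncomputable def OverlapQuotient.down {χ : CutOff} {κ : ℕ} {P P' : SetPartition κ} {δ : ℝ}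
    {d e : ℕ → ℝ} : OverlapQuotient χ P P' δ d e → SplicingQuotient χ P δ d :=
  Quot.lift (fun u => SplicingQuotient.mk ⟨overlapDown χ u.2.1, u.2.2.2.2.2.2⟩)
    fun _ _ ⟨σ, h⟩ => Quot.sound ⟨σ, h.overlapDown χ⟩

theorem mainTheorem5 (χ : CutOff) (κ : ℕ) (P P' : SetPartition κ) (hP : P' ≤ P)
    (δ : ℝ) (hδ : 0 < δ) (d e : ℕ → ℝ) (hd : ∀ k, 0 < d k) (he : ∀ k, 0 < e k) :
    -- near the trivial stratum the overlap domains contain all trivial data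
    (∀ Q : conjugateRefinements P P', ∃ N : Set ((P.parts → R4) × (Q.1.parts → R4)),
      IsOpen N ∧ (∀ y ∈ openDiagonal (blockCard P) δ, (y, 0) ∈ N) ∧
      ∀ a ∈ overlapSpace P Q.1 δ d e, (a.base, a.off) ∈ N →
        (∀ C : Q.1.parts, a.ideal C = coneIdeal C.1.card) → a ∈ overlapDomain χ Q.2.2 δ d e) ∧
    -- the square commutes before passing to quotients
    (∀ a ∈ overlapDomain χ hP δ d e,
      splicingMap χ (blockCard P') (overlapUp hP a) =
        splicingMap χ (blockCard P) (overlapDown χ a)) ∧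
    -- all maps pass to the quotients, and the square of quotients commutes
    ∃ (ρu : OverlapQuotient χ P P' δ d e → UpperQuotient χ P P' δ e)
      (ρd : OverlapQuotient χ P P' δ d e → SplicingQuotient χ P δ d)
      (γu : UpperQuotient χ P P' δ e → idealSpace κ (2 * δ))
      (γd : SplicingQuotient χ P δ d → idealSpace κ (2 * δ)),
      (∀ (Q : conjugateRefinements P P') (a : overlapDomain χ Q.2.2 δ d e),
        ρu (OverlapQuotient.mk Q a) =
          UpperQuotient.mk Q ⟨overlapUp Q.2.2 a.1, a.2.2.2.1⟩) ∧
      (∀ (Q : conjugateRefinements P P') (a : overlapDomain χ Q.2.2 δ d e),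
        ρd (OverlapQuotient.mk Q a) =
          SplicingQuotient.mk ⟨overlapDown χ a.1, a.2.2.2.2.2⟩) ∧
      (∀ (Q : conjugateRefinements P P') (D : splicingDomain χ (blockCard Q.1) κ δ e),
        γu (UpperQuotient.mk Q D) = ⟨splicingMap χ (blockCard Q.1) D.1, D.2.2.2.2⟩) ∧
      (∀ D : splicingDomain χ (blockCard P) κ δ d,
        γd (SplicingQuotient.mk D) = ⟨splicingMap χ (blockCard P) D.1, D.2.2.2.2⟩) ∧
      ∀ q, γu (ρu q) = γd (ρd q) := by
  refine ⟨fun Q => ⟨apartConfigurations Q.2.2 δ, isOpen_apartConfigurations Q.2.2 δ,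
      fun y hy => mem_apartConfigurations Q.2.2 hy, fun a ha hN hcone =>
        mem_overlapDomain_of_cone χ Q.2.2 hδ hd he ha hN hcone⟩,
    fun a ha => splicingMap_overlapUp_of_mem χ hP ha,
    OverlapQuotient.up, OverlapQuotient.down, UpperQuotient.splice, SplicingQuotient.splice,
    fun _ _ => rfl, fun _ _ => rfl, fun _ _ => rfl, fun _ => rfl, ?_⟩
  -- On representatives all four maps compute by definition, leaving associativity for the conjugate
  -- refinement `Q`.
  rintro ⟨Q, a, ha⟩
  exact Subtype.ext (splicingMap_overlapUp_of_mem χ Q.2.2 ha)
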